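/- Let $d\ge 2$, and write $B(x,r)$ for the closed Euclidean ball in $\mathbb{R}^d$. Let $A(d,1)$ be the space of (bi-infinite) lines in $\mathbb{R}^d$, and let $\mu_{d,1}$ be the measure on $A(d,1)$ that is invariant under all isometries of $\mathbb{R}^d$, normalized so that the set of lines meeting $B(0,1)$ has measure $1$. Let $\Psi$ be a Poisson point process on $A(d,1)\times[0,\infty)$ with intensity measure $\mu_{d,1}\times(\text{Lebesgue measure})$. For a line $L$ let $\mathfrak{c}(L)=\{x\in\mathbb{R}^d: \operatorname{dist}(x,L)\le 1\}$. For a bounded set $A\subset\mathbb{R}^d$ and $\rho\in(0,1)$ let $A^\rho$ be a set of points of $A$, any two distinct ones at distance at least $\rho$, with the maximal possible number $|A^\rho|$ of points (any such choice is allowed). Let $$T_w^\rho(A)=\inf\{t>0:\ \forall x\in A^\rho\ \exists (L,s)\in\Psi \text{ with } B(x,\rho)\subset\mathfrak{c}(L)\text{ and } s\le t\},$$ with $\inf\emptyset=\infty$. Put $\gamma(\rho)=(1-\rho)^{d-1}$, $C_d=\sqrt{1-4^{-1/(d-2)}}$ for $d\ge 3$, $C_2=1$, and $\tilde C_d=\frac{C_d}{12(1+C_d)}$.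 Theorem. For every $d\ge2$ there is a constant $c_3\in(0,\infty)$ depending only on $d$ such that the following holds for every bounded $A\subset\mathbb{R}^d$ and every $\rho$. If 1. $0<\rho<\min\left(\frac{d-1}{6d},\frac{C_d}{5}\right)$, 2. $|A^\rho|^{1/(2d)}>4$, 3. $\rho\log|A^\rho|\le|A^\rho|^{\rho/200}$, 4. $|A^\rho|^{\rho/200}\ge 2$, 5. $\rho^{-d}(\log|A^\rho|)^d\le|A^\rho|^{\tilde C_d/2}$, then $$\sup_{z\in\mathbb{R}}\left|\mathbb{P}\left(\gamma(\rho)T_w^\rho(A)-\log|A^\rho|\le z\right)-\exp(-e^{-z})\right|\le c_3|A^\rho|^{-\rho/600}.$$ -/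

import Mathlib

open MeasureTheory ProbabilityTheory Metric
open scoped NNReal ENNReal

namespace PoissonCylinder

/-- Euclidean space `ℝᵈ`. -/
abbrev Space (d : ℕ) : Type := EuclideanSpace ℝ (Fin d)

/-- The space `A(d,1)` of bi-infinite lines in `ℝᵈ`: the nonempty affine subspaces whose direction
is one-dimensional. -/
def Line (d : ℕ) : Type :=
  {L : AffineSubspace ℝ (Space d) //
    (L : Set (Space d)).Nonempty ∧ Module.finrank ℝ L.direction = 1}

/-- The set of points of a line. -/
def Line.points {d : ℕ} (L : Line d) : Set (Space d) := (L.1 : Set (Space d))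

/-- The set of all lines that meet `K`. -/
def hitting {d : ℕ} (K : Set (Space d)) : Set (Line d) := {L | (L.points ∩ K).Nonempty}

/-- The usual (hit-or-miss) σ-algebra on the space of lines, generated by the sets of lines that
meet a given compact set. -/
instance (d : ℕ) : MeasurableSpace (Line d) :=
  MeasurableSpace.generateFrom {H | ∃ K : Set (Space d), IsCompact K ∧ H = hitting K}

/-- The line `y + ℝ u` through the point `y` with unit direction vector `u`. -/
noncomputable def lineThrough {d : ℕ} (u : sphere (0 : Space d) 1) (y : Space d) : Line d :=
  ⟨AffineSubspace.mk' y (ℝ ∙ (u : Space d)), AffineSubspace.mk'_nonempty _ _, by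
    rw [AffineSubspace.direction_mk']
    exact finrank_span_singleton (ne_zero_of_mem_unit_sphere u)⟩

/-- The uniform (rotation invariant) probability measure on the unit sphere. Its image under
`u ↦ ℝ u` is the normalized invariant measure on the space of lines through the origin. -/
noncomputable def sphereMeasure (d : ℕ) : Measure (sphere (0 : Space d) 1) :=
  ((volume : Measure (Space d)).toSphere Set.univ)⁻¹ • (volume : Measure (Space d)).toSphere

/-- The volume `κ_d` of the unit ball of `ℝᵈ`. -/
noncomputable def unitBallVolume (d : ℕ) : ℝ≥0∞ := volume (closedBall (0 : Space d) 1)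

/-- The motion invariant measure on the space of lines in `ℝᵈ`, normalized so that the set of lines
which meet the unit ball has measure one. A uniformly distributed direction `u` is combined with a
translation `y` which is distributed according to `(d-1)`-dimensional Lebesgue measure on the
orthogonal complement of `u`. See `lineMeasure_apply` and `lineMeasure_hitting_unitBall`. -/
noncomputable def lineMeasure (d : ℕ) : Measure (Line d) :=
  (unitBallVolume (d - 1))⁻¹ •
    (sphereMeasure d).bind fun u =>
      (volume : Measure (ℝ ∙ (u : Space d))ᗮ).map
        fun y : (ℝ ∙ (u : Space d))ᗮ => lineThrough u (y : Space d)

theorem mem_points_lineThrough {d : ℕ} (u : sphere (0 : Space d) 1) (y x : Space d) :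
    x ∈ (lineThrough u y).points ↔ ∃ t : ℝ, x = y + t • (u : Space d) := by
  change x ∈ AffineSubspace.mk' y (ℝ ∙ (u : Space d)) ↔ _
  rw [AffineSubspace.mem_mk', Submodule.mem_span_singleton]
  constructor
  · rintro ⟨t, ht⟩
    exact ⟨t, by rw [ht]; simp⟩
  · rintro ⟨t, rfl⟩
    exact ⟨t, by simp⟩

theorem measurable_lineThrough (d : ℕ) :
    Measurable fun p : sphere (0 : Space d) 1 × Space d => lineThrough p.1 p.2 := by
  refine measurable_generateFrom ?_
  rintro _ ⟨K, hK, rfl⟩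
  have h : (fun p : sphere (0 : Space d) 1 × Space d => lineThrough p.1 p.2) ⁻¹' hitting K =
      ⋃ n : ℕ, Prod.snd '' {q : Set.Icc (-(n : ℝ)) n × (sphere (0 : Space d) 1 × Space d) |
        q.2.2 + (q.1 : ℝ) • (q.2.1 : Space d) ∈ K} := by
    ext p
    simp only [Set.mem_preimage, Set.mem_iUnion, Set.mem_image, Set.mem_ofPred_eq]
    constructor
    · rintro ⟨x, hx, hxK⟩
      obtain ⟨t, rfl⟩ := (mem_points_lineThrough _ _ _).1 hx
      obtain ⟨n, hn⟩ := exists_nat_ge |t|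
      exact ⟨n, (⟨t, abs_le.1 hn⟩, p), hxK, rfl⟩
    · rintro ⟨n, ⟨t, q⟩, hq, rfl⟩
      exact ⟨_, (mem_points_lineThrough _ _ _).2 ⟨t, rfl⟩, hq⟩
  rw [h]
  refine MeasurableSet.iUnion fun n => IsClosed.measurableSet ?_
  refine isClosedMap_snd_of_compactSpace _ (hK.isClosed.preimage ?_)
  fun_prop

theorem measurable_lineThrough_coe {d : ℕ} (u : sphere (0 : Space d) 1)
    (V : Submodule ℝ (Space d)) : Measurable fun y : V => lineThrough u (y : Space d) := by
  intro H hH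
  have h2 := measurable_lineThrough d hH
  have h : Measurable fun y : V => (u, (y : Space d)) :=
    measurable_const.prodMk measurable_subtype_coe
  exact h h2

theorem lineThrough_proj {d : ℕ} (u : sphere (0 : Space d) 1) (x : Space d) :
    lineThrough u ((ℝ ∙ (u : Space d))ᗮ.orthogonalProjectionOnto x : Space d) =
      lineThrough u x := by
  apply Subtype.ext
  change AffineSubspace.mk' _ _ = AffineSubspace.mk' _ _
  have h : x - ((ℝ ∙ (u : Space d))ᗮ.orthogonalProjectionOnto x : Space d) ∈
      ℝ ∙ (u : Space d) := by
    have := (ℝ ∙ (u : Space d))ᗮ.sub_starProjection_mem_orthogonal x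
    rwa [Submodule.orthogonal_orthogonal] at this
  ext z
  rw [AffineSubspace.mem_mk', AffineSubspace.mem_mk', vsub_eq_sub, vsub_eq_sub,
    ← sub_add_sub_cancel z x]
  exact Submodule.add_mem_iff_left _ h

theorem volume_transversal {d : ℕ} (u : sphere (0 : Space d) 1) {H : Set (Line d)}
    (hH : MeasurableSet H) :
    volume {y : (ℝ ∙ (u : Space d))ᗮ | lineThrough u (y : Space d) ∈ H} =
      volume {x : Space d | inner ℝ (u : Space d) x ∈ Set.Icc (0 : ℝ) 1 ∧
        lineThrough u x ∈ H} := by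
  have hu : ‖(u : Space d)‖ = 1 := norm_eq_of_mem_sphere u
  set V : Submodule ℝ (Space d) := ℝ ∙ (u : Space d) with hV
  have he : MeasurePreserving (fun x : Space d =>
      (V.orthogonalProjectionOnto x, Vᗮ.orthogonalProjectionOnto x)) := by
    have := (WithLp.volume_preserving_ofLp V Vᗮ).comp V.orthogonalDecomposition.measurePreserving
    convert this using 1
    ext x <;> simp
  have hI : volume {k : V | inner ℝ (u : Space d) (k : Space d) ∈ Set.Icc (0 : ℝ) 1} = 1 := by
    have hm := (LinearIsometryEquiv.toSpanUnitSingleton (𝕜 := ℝ) (u : Space d) hu).measurePreserving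
    have hIm : MeasurableSet {k : V | inner ℝ (u : Space d) (k : Space d) ∈ Set.Icc (0 : ℝ) 1} :=
      (isClosed_Icc.preimage (by fun_prop)).measurableSet
    rw [← hm.measure_preimage hIm.nullMeasurableSet]
    have hpre : (LinearIsometryEquiv.toSpanUnitSingleton (𝕜 := ℝ) (u : Space d) hu) ⁻¹'
        {k : V | inner ℝ (u : Space d) (k : Space d) ∈ Set.Icc (0 : ℝ) 1} = Set.Icc (0 : ℝ) 1 := by
      ext t
      rw [Set.mem_preimage, LinearIsometryEquiv.toSpanUnitSingleton_apply, Set.mem_ofPred_eq]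
      simp [inner_smul_right, hu]
    rw [hpre]
    simp
  have hS : MeasurableSet {y : Vᗮ | lineThrough u (y : Space d) ∈ H} :=
    measurable_lineThrough_coe u _ hH
  have hIm : MeasurableSet {k : V | inner ℝ (u : Space d) (k : Space d) ∈ Set.Icc (0 : ℝ) 1} :=
    (isClosed_Icc.preimage (by fun_prop)).measurableSet
  calc volume {y : Vᗮ | lineThrough u (y : Space d) ∈ H}
      = volume ({k : V | inner ℝ (u : Space d) (k : Space d) ∈ Set.Icc (0 : ℝ) 1} ×ˢ
          {y : Vᗮ | lineThrough u (y : Space d) ∈ H}) := by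
        rw [Measure.volume_eq_prod, Measure.prod_prod, hI, one_mul]
    _ = _ := by
        rw [← he.measure_preimage (hIm.prod hS).nullMeasurableSet]
        congr 1
        ext x
        have h1 : inner ℝ (u : Space d) (V.orthogonalProjectionOnto x : Space d) =
            inner ℝ (u : Space d) x := by
          have := V.starProjection_inner_eq_zero x (u : Space d)
            (Submodule.mem_span_singleton_self _)
          rw [real_inner_comm, inner_sub_right] at this
          simpa using (sub_eq_zero.1 this).symm
        have h2 : lineThrough u (Vᗮ.orthogonalProjectionOnto x : Space d) = lineThrough u x :=
          lineThrough_proj u x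
        simp only [Set.mem_preimage, Set.mem_prod, Set.mem_ofPred_eq, h1]
        rw [h2]

theorem measurable_lineKernel (d : ℕ) :
    Measurable fun u : sphere (0 : Space d) 1 =>
      (volume : Measure (ℝ ∙ (u : Space d))ᗮ).map
        fun y : (ℝ ∙ (u : Space d))ᗮ => lineThrough u (y : Space d) := by
  refine Measure.measurable_of_measurable_coe _ fun H hH => ?_
  have h : ∀ u : sphere (0 : Space d) 1,
      (volume : Measure (ℝ ∙ (u : Space d))ᗮ).map
        (fun y : (ℝ ∙ (u : Space d))ᗮ => lineThrough u (y : Space d)) H =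
      volume (Prod.mk u ⁻¹' {p : sphere (0 : Space d) 1 × Space d |
        inner ℝ (p.1 : Space d) p.2 ∈ Set.Icc (0 : ℝ) 1 ∧ lineThrough p.1 p.2 ∈ H}) := by
    intro u
    rw [Measure.map_apply (measurable_lineThrough_coe u _) hH]
    exact volume_transversal u hH
  simp_rw [h]
  refine measurable_measure_prodMk_left (MeasurableSet.inter ?_ (measurable_lineThrough d hH))
  exact (isClosed_Icc.preimage (by fun_prop)).measurableSet

/-- The integral representation of the invariant measure. -/
theorem lineMeasure_apply (d : ℕ) {H : Set (Line d)} (hH : MeasurableSet H) :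
    lineMeasure d H = (unitBallVolume (d - 1))⁻¹ *
      ∫⁻ u, volume {y : (ℝ ∙ (u : Space d))ᗮ | lineThrough u (y : Space d) ∈ H}
        ∂(sphereMeasure d) := by
  rw [lineMeasure, Measure.smul_apply, smul_eq_mul,
    Measure.bind_apply hH (measurable_lineKernel d).aemeasurable]
  congr 1
  refine lintegral_congr fun u => ?_
  rw [Measure.map_apply (measurable_lineThrough_coe u _) hH]
  rfl

theorem measurableSet_hitting {d : ℕ} {K : Set (Space d)} (hK : IsCompact K) :
    MeasurableSet (hitting K : Set (Line d)) :=
  MeasurableSpace.measurableSet_generateFrom ⟨K, hK, rfl⟩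

/-- The invariant measure is normalized. -/
theorem lineMeasure_hitting_unitBall {d : ℕ} (hd : 2 ≤ d) :
    lineMeasure d (hitting (closedBall 0 1)) = 1 := by
  rw [lineMeasure_apply d (measurableSet_hitting (isCompact_closedBall _ _))]
  have h : ∀ u : sphere (0 : Space d) 1,
      volume {y : (ℝ ∙ (u : Space d))ᗮ |
        lineThrough u (y : Space d) ∈ hitting (closedBall (0 : Space d) 1)} =
      unitBallVolume (d - 1) := by
    intro u
    have hf : Module.finrank ℝ (ℝ ∙ (u : Space d))ᗮ = d - 1 := by
      have := (ℝ ∙ (u : Space d)).finrank_add_finrank_orthogonal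
      rw [finrank_span_singleton (ne_zero_of_mem_unit_sphere u), finrank_euclideanSpace_fin] at this
      omega
    have : Nontrivial (ℝ ∙ (u : Space d))ᗮ := Module.nontrivial_of_finrank_pos (R := ℝ) (by omega)
    have : Nonempty (Fin (d - 1)) := ⟨⟨0, by omega⟩⟩
    have hset : {y : (ℝ ∙ (u : Space d))ᗮ |
        lineThrough u (y : Space d) ∈ hitting (closedBall (0 : Space d) 1)} = closedBall 0 1 := by
      ext y
      have hy : inner ℝ (y : Space d) (u : Space d) = 0 :=
        Submodule.inner_left_of_mem_orthogonal (Submodule.mem_span_singleton_self _) y.2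
      simp only [Set.mem_ofPred_eq, mem_closedBall, dist_zero_right]
      constructor
      · rintro ⟨x, hx, hxB⟩
        obtain ⟨t, rfl⟩ := (mem_points_lineThrough _ _ _).1 hx
        have h1 : ‖(y : Space d) + t • (u : Space d)‖ ≤ 1 := by simpa using hxB
        have h2 : ‖(y : Space d) + t • (u : Space d)‖ ^ 2 =
            ‖(y : Space d)‖ ^ 2 + ‖t • (u : Space d)‖ ^ 2 := by
          rw [norm_add_sq_real, inner_smul_right, hy]; ring
        have h3 : ‖(y : Space d)‖ ≤ 1 := by
          nlinarith [norm_nonneg (y : Space d), norm_nonneg ((y : Space d) + t • (u : Space d)),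
            sq_nonneg ‖t • (u : Space d)‖]
        exact h3
      · intro h1
        exact ⟨y, (mem_points_lineThrough _ _ _).2 ⟨0, by simp⟩, by simpa using h1⟩
    rw [hset, unitBallVolume, InnerProductSpace.volume_closedBall,
      InnerProductSpace.volume_closedBall, hf, finrank_euclideanSpace_fin]
  simp_rw [h]
  have hne : Nonempty (Fin d) := ⟨⟨0, by omega⟩⟩
  have hs : sphereMeasure d Set.univ = 1 := by
    rw [sphereMeasure, Measure.smul_apply, smul_eq_mul]
    refine ENNReal.inv_mul_cancel ?_ (measure_ne_top _ _)
    rw [Ne, Measure.measure_univ_eq_zero]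
    exact Measure.toSphere_ne_zero _
  rw [lintegral_const, hs, mul_one]
  refine ENNReal.inv_mul_cancel (measure_closedBall_pos _ _ one_pos).ne' ?_
  exact (isCompact_closedBall _ _).measure_ne_top

/-- The closed cylinder of base radius one around the line `L`. -/
def cylinder {d : ℕ} (L : Line d) : Set (Space d) := {x | infDist x L.points ≤ 1}

/-- Lebesgue measure on the half-line `[0, ∞)` of time-stamps. -/
noncomputable def timeMeasure : Measure ℝ≥0 :=
  (volume : Measure ℝ).comap ((↑) : ℝ≥0 → ℝ)

/-- A Poisson point process with intensity measure `μ`, as a random countable set of points: the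
number of points in a measurable set `B` is Poisson distributed with mean `μ B` (and infinite almost
surely if `μ B = ∞`), and the numbers of points in pairwise disjoint sets are independent. -/
structure IsPoissonProcess {Ω X : Type*} [MeasurableSpace Ω] [MeasurableSpace X]
    (Ψ : Ω → Set X) (μ : Measure X) (P : Measure Ω) : Prop where
  countable : ∀ ω, (Ψ ω).Countable
  measurable_count : ∀ B : Set X, MeasurableSet B → Measurable fun ω => (Ψ ω ∩ B).encard
  law_count : ∀ B : Set X, MeasurableSet B → μ B ≠ ∞ →
    P.map (fun ω => (Ψ ω ∩ B).encard) =
      (poissonMeasure (μ B).toNNReal).map ((↑) : ℕ → ℕ∞)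
  count_eq_top : ∀ B : Set X, MeasurableSet B → μ B = ∞ → ∀ᵐ ω ∂P, (Ψ ω ∩ B).encard = ⊤
  indep_count : ∀ (n : ℕ) (B : Fin n → Set X), (∀ i, MeasurableSet (B i)) →
    Pairwise (fun i j => Disjoint (B i) (B j)) →
    iIndepFun (fun i ω => (Ψ ω ∩ B i).encard) P

/-- Any two distinct points of `S` have distance at least `ρ`. -/
def IsRhoSeparated {d : ℕ} (ρ : ℝ) (S : Finset (Space d)) : Prop :=
  ∀ x ∈ S, ∀ y ∈ S, x ≠ y → ρ ≤ dist x y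

/-- `S` is a possible choice of `A^ρ`: a `ρ`-separated subset of `A` with the maximal number of
points. -/
structure IsMaximalSeparated {d : ℕ} (ρ : ℝ) (A : Set (Space d)) (S : Finset (Space d)) :
    Prop where
  subset : (S : Set (Space d)) ⊆ A
  separated : IsRhoSeparated ρ S
  maximal : ∀ T : Finset (Space d), (T : Set (Space d)) ⊆ A → IsRhoSeparated ρ T →
    T.card ≤ S.card

/-- The `ρ`-well cover time, for a configuration `Ψ` of lines with time-stamps and `S = A^ρ`: the
infimum of all times `t > 0` such that every ball `B(x,ρ)`, `x ∈ S`, is contained in a single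
cylinder with time-stamp at most `t` (and `+∞` if there is no such time). -/
noncomputable def wellCoverTime {d : ℕ} (Ψ : Set (Line d × ℝ≥0)) (ρ : ℝ)
    (S : Finset (Space d)) : EReal :=
  sInf ((fun t : ℝ => (t : EReal)) ''
    {t : ℝ | 0 < t ∧ ∀ x ∈ S, ∃ p ∈ Ψ, closedBall x ρ ⊆ cylinder p.1 ∧ (p.2 : ℝ) ≤ t})

/-- `γ(ρ) = (1 - ρ)^(d-1)`. -/
noncomputable def gam (d : ℕ) (ρ : ℝ) : ℝ := (1 - ρ) ^ (d - 1)

/-- `C_d = √(1 - 4^(-1/(d-2)))`, where `C_2 = 1`. -/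
noncomputable def constC (d : ℕ) : ℝ :=
  if d = 2 then 1 else Real.sqrt (1 - (4 : ℝ) ^ (-1 / ((d : ℝ) - 2)))

/-- `C_d / (12 (1 + C_d))`. -/
noncomputable def constCtilde (d : ℕ) : ℝ := constC d / (12 * (1 + constC d))

end PoissonCylinder

open PoissonCylinder

open scoped Pointwise

/-! Write N for the number of points. By time t the point x is still uncovered exactly when the
Poisson process has no point in H_x × [0,t], where H_x is the set of lines meeting B(x, 1-ρ). Since
H_x has measure (1-ρ)^(d-1) = γ, this has probability p = exp(-γt), and t = (log N + z)/γ makes Np =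
e^{-z}. If the number W of uncovered points is nearly Poisson with mean Np, then the probability of
full coverage, P(W = 0), is nearly exp(-e^{-z}).

The Poisson approximation is the Stein–Chen method with a monotone coupling. Given that H_x × [0,t]
is empty, the point y is uncovered iff (H_y \ H_x) × [0,t] is empty. This event J_xy contains the
event that y is uncovered, and the family (J_xy)_y is independent of the event at x, because the
underlying sets are disjoint. The error is then at most the maximum over x of ∑_{y ≠ x} (P(J_xy) -
p) + p (`abs_measureReal_biInter_compl_sub_exp_le`).

Here P(J_xy) = exp(-t μ(H_y \ H_x)), so lower bounds for μ(H_y \ H_x) are needed: relative to γ it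
is at least |x-y|/12 when |x-y| ≤ 3, and at least 1/2 and 1 - K|x-y|^{-(d-1)} when |x-y| ≥ 3. They
reduce to volumes of balls in the hyperplanes orthogonal to the directions of the lines. With
packing bounds for separated sets they make the sum O(N^{-ρ/600}) (`exists_sum_exp_sub_exp_le`).

This handles -log log N ≤ z ≤ log N. Larger z follow from a union bound, smaller z from
monotonicity, and the infimum defining the cover time is compared with coverage at fixed times
through the continuity of the Gumbel distribution function. -/

namespace PoissonCylinder

/-! ### The Stein equation for the Poisson law at {0} -/

/-- The solution of the Stein equation for the Poisson distribution with mean `l` and the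
set `{0}`, shifted by one. -/
noncomputable def steinSol (l : ℝ) (k : ℕ) : ℝ := ∫ s in (0 : ℝ)..1, s ^ k * Real.exp (-l * s)

theorem intervalIntegrable_pow_mul_exp (l : ℝ) (k : ℕ) :
    IntervalIntegrable (fun s : ℝ => s ^ k * Real.exp (-l * s)) volume 0 1 :=
  Continuous.intervalIntegrable (by fun_prop) _ _

/-- The fundamental theorem of calculus for s^w e^{-ls} on [0,1]. The term 0^w is the indicator of w
= 0, and the truncated w - 1 at w = 0 is harmless because its coefficient vanishes. -/
theorem steinSol_equation (l : ℝ) (w : ℕ) :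
    w * steinSol l (w - 1) - l * steinSol l w = Real.exp (-l) - 0 ^ w := by
  have hd : ∀ s ∈ Set.uIcc (0 : ℝ) 1, HasDerivAt (fun s : ℝ => s ^ w * Real.exp (-l * s))
      (w * (s ^ (w - 1) * Real.exp (-l * s)) - l * (s ^ w * Real.exp (-l * s))) s := by
    intro s _
    have h2 : HasDerivAt (fun s : ℝ => -l * s) (-l) s := by
      simpa using (hasDerivAt_id s).const_mul (-l)
    have h1 : HasDerivAt (fun s : ℝ => s ^ w * Real.exp (-l * s)) _ s :=
      (hasDerivAt_pow w s).mul h2.exp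
    refine h1.congr_deriv ?_
    ring
  have h := intervalIntegral.integral_eq_sub_of_hasDerivAt hd
    (((intervalIntegrable_pow_mul_exp l (w - 1)).const_mul _).sub
      ((intervalIntegrable_pow_mul_exp l w).const_mul _))
  rw [intervalIntegral.integral_sub ((intervalIntegrable_pow_mul_exp l (w - 1)).const_mul _)
    ((intervalIntegrable_pow_mul_exp l w).const_mul _),
    intervalIntegral.integral_const_mul, intervalIntegral.integral_const_mul] at h
  simpa [steinSol] using h

theorem integral_exp_neg_mul_le {l : ℝ} (hl : 0 < l) :
    ∫ s in (0 : ℝ)..1, Real.exp (-l * s) ≤ l⁻¹ := by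
  have h := steinSol_equation l 0
  simp only [steinSol, pow_zero, one_mul, CharP.cast_eq_zero, zero_mul, zero_sub] at h
  rw [← one_div, le_div_iff₀ hl]
  nlinarith [Real.exp_pos (-l)]

theorem abs_pow_sub_pow_le_of_mem_unit {s : ℝ} (h0 : 0 ≤ s) (h1 : s ≤ 1) (j k : ℕ) :
    |s ^ j - s ^ k| ≤ |(j : ℝ) - k| := by
  wlog h : j ≤ k generalizing j k
  · rw [abs_sub_comm, abs_sub_comm (j : ℝ)]
    exact this k j (by omega)
  obtain ⟨m, rfl⟩ := Nat.exists_eq_add_of_le h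
  have hm : 1 - s ^ m ≤ m := by
    have := one_add_mul_le_pow (a := s - 1) (by linarith) m
    have hms : (m : ℝ) * s ≥ 0 := by positivity
    have h2 : (1 + (s - 1)) = s := by ring
    rw [h2] at this
    nlinarith
  have hm0 : s ^ m ≤ 1 := pow_le_one₀ h0 h1
  have hj0 : s ^ j ≤ 1 := pow_le_one₀ h0 h1
  have hj1 : 0 ≤ s ^ j := pow_nonneg h0 j
  have e : s ^ j - s ^ (j + m) = s ^ j * (1 - s ^ m) := by ring
  rw [e, abs_of_nonneg (mul_nonneg hj1 (by linarith))]
  push_cast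
  rw [show (j : ℝ) - (j + m) = -(m : ℝ) by ring, abs_neg, Nat.abs_cast]
  nlinarith

/-- On [0,1] the powers s^j and s^k differ by at most |j - k|, and e^{-ls} has integral at most 1/l.
The Lipschitz constant 1/l later cancels the total mass l of the events, so that the final error
carries no factor depending on the mean. -/
theorem abs_steinSol_sub_le {l : ℝ} (hl : 0 < l) (j k : ℕ) :
    |steinSol l j - steinSol l k| ≤ |(j : ℝ) - k| * l⁻¹ := by
  have hb : |steinSol l j - steinSol l k| ≤
      ∫ s in (0 : ℝ)..1, |(j : ℝ) - k| * Real.exp (-l * s) := by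
    rw [steinSol, steinSol, ← intervalIntegral.integral_sub (intervalIntegrable_pow_mul_exp l j)
      (intervalIntegrable_pow_mul_exp l k), ← Real.norm_eq_abs]
    refine intervalIntegral.norm_integral_le_of_norm_le zero_le_one ?_
      (Continuous.intervalIntegrable (by fun_prop) _ _)
    refine Filter.Eventually.of_forall fun s hs => ?_
    rw [← sub_mul, norm_mul, Real.norm_eq_abs, Real.norm_eq_abs, Real.abs_exp]
    exact mul_le_mul_of_nonneg_right (abs_pow_sub_pow_le_of_mem_unit hs.1.le hs.2 j k)
      (Real.exp_pos _).le
  rw [intervalIntegral.integral_const_mul] at hb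
  exact hb.trans (mul_le_mul_of_nonneg_left (integral_exp_neg_mul_le hl) (abs_nonneg _))

/-! ### The Stein–Chen bound under a monotone coupling -/

section SteinChen

variable {Ω ι : Type*}

open scoped Classical in
/-- The number of the events `E x`, `x ∈ S`, that occur. -/
noncomputable def countEvents (S : Finset ι) (E : ι → Set Ω) (ω : Ω) : ℕ :=
  (S.filter fun x => ω ∈ E x).card

theorem countEvents_eq_sum (S : Finset ι) (E : ι → Set Ω) (ω : Ω) :
    (countEvents S E ω : ℝ) = ∑ x ∈ S, (E x).indicator (fun _ => (1 : ℝ)) ω := by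
  classical
  simp only [countEvents, Set.indicator_apply, Finset.sum_boole]

theorem countEvents_eq_sum_nat (S : Finset ι) (E : ι → Set Ω) (ω : Ω) :
    countEvents S E ω = ∑ x ∈ S, (E x).indicator (fun _ => (1 : ℕ)) ω := by
  classical
  simp only [countEvents, Set.indicator_apply, Finset.sum_boole, Nat.cast_id]

theorem measurable_countEvents {m : MeasurableSpace Ω} {S : Finset ι} {E : ι → Set Ω}
    (hE : ∀ x ∈ S, MeasurableSet[m] (E x)) : Measurable[m] (countEvents S E) := by
  have h : countEvents S E = fun ω => ∑ x ∈ S, (E x).indicator (fun _ => (1 : ℕ)) ω :=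
    funext fun ω => countEvents_eq_sum_nat S E ω
  rw [h]
  exact Finset.measurable_fun_sum _ fun x hx => measurable_const.indicator (hE x hx)

theorem countEvents_le (S : Finset ι) (E : ι → Set Ω) (ω : Ω) : countEvents S E ω ≤ S.card := by
  classical
  exact Finset.card_filter_le _ _

theorem integrable_comp_countEvents [MeasurableSpace Ω] (P : Measure Ω) [IsProbabilityMeasure P] {S : Finset ι}
    {E : ι → Set Ω} (hE : ∀ x ∈ S, MeasurableSet (E x)) (g : ℕ → ℝ) :
    Integrable (fun ω => g (countEvents S E ω)) P := by
  refine Integrable.of_bound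
    ((Measurable.of_discrete (f := g)).comp (measurable_countEvents hE)).aestronglyMeasurable
    (∑ k ∈ Finset.range (S.card + 1), ‖g k‖) (Filter.Eventually.of_forall fun ω => ?_)
  exact Finset.single_le_sum (f := fun k => ‖g k‖) (fun _ _ => norm_nonneg _)
    (Finset.mem_range.2 (Nat.lt_succ_of_le (countEvents_le S E ω)))

theorem integral_countEvents [MeasurableSpace Ω] (P : Measure Ω) [IsProbabilityMeasure P] {S : Finset ι}
    {E : ι → Set Ω} (hE : ∀ x ∈ S, MeasurableSet (E x)) :
    ∫ ω, (countEvents S E ω : ℝ) ∂P = ∑ x ∈ S, P.real (E x) := by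
  simp_rw [countEvents_eq_sum]
  rw [integral_finsetSum]
  · exact Finset.sum_congr rfl fun x hx => by
      rw [integral_indicator_const _ (hE x hx)]; simp
  · exact fun x hx => (integrable_const _).indicator (hE x hx)

/-- If an event is independent of all the intersections of a finite family of events, then it is
independent of the number of the events that occur. -/
theorem integral_indicator_mul_comp_countEvents [MeasurableSpace Ω] (P : Measure Ω) [IsProbabilityMeasure P]
    {S : Finset ι} {E : ι → Set Ω} (hE : ∀ x ∈ S, MeasurableSet (E x)) {A : Set Ω}
    (hA : MeasurableSet A)
    (hind : ∀ U ⊆ S, P.real (A ∩ ⋂ y ∈ U, E y) = P.real A * P.real (⋂ y ∈ U, E y)) (g : ℕ → ℝ) :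
    ∫ ω, A.indicator (fun _ => (1 : ℝ)) ω * g (countEvents S E ω) ∂P =
      P.real A * ∫ ω, g (countEvents S E ω) ∂P := by
  classical
  -- Intersections of subfamilies form a π-system, so independence on it passes to the generated
  -- σ-algebra, for which the count is measurable.
  set π : Set (Set Ω) := {B | ∃ U ⊆ S, B = ⋂ y ∈ U, E y} with hπ
  have hπm : ∀ B ∈ π, MeasurableSet B := by
    rintro _ ⟨U, hU, rfl⟩
    exact Finset.measurableSet_biInter U fun y hy => hE y (hU hy)
  have hπi : IsPiSystem π := by
    rintro _ ⟨U, hU, rfl⟩ _ ⟨V, hV, rfl⟩ _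
    exact ⟨U ∪ V, Finset.union_subset hU hV, by
      ext ω; simp [or_imp, forall_and]⟩
  have hindep : Indep (MeasurableSpace.generateFrom {A}) (MeasurableSpace.generateFrom π) P := by
    refine IndepSets.indep (MeasurableSpace.generateFrom_le fun t ht => ?_)
      (MeasurableSpace.generateFrom_le hπm) (IsPiSystem.singleton A) hπi rfl rfl ?_
    · rw [Set.mem_singleton_iff.1 ht]; exact hA
    · rw [IndepSets_iff]
      rintro t1 _ ht1 ⟨U, hU, rfl⟩
      rw [Set.mem_singleton_iff.1 ht1]
      have := hind U hU
      rw [measureReal_def, measureReal_def, measureReal_def, ← ENNReal.toReal_mul] at this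
      exact (ENNReal.toReal_eq_toReal_iff' (measure_ne_top _ _)
        (ENNReal.mul_ne_top (measure_ne_top _ _) (measure_ne_top _ _))).1 this
  have hf : Measurable[MeasurableSpace.generateFrom {A}] (A.indicator fun _ => (1 : ℝ)) :=
    (measurable_const).indicator (MeasurableSpace.measurableSet_generateFrom rfl)
  have hc : Measurable[MeasurableSpace.generateFrom π] (countEvents S E) := by
    refine measurable_countEvents fun x hx => MeasurableSpace.measurableSet_generateFrom ?_
    exact ⟨{x}, by simpa using hx, by simp⟩
  have hg : Measurable[MeasurableSpace.generateFrom π] (fun ω => g (countEvents S E ω)) :=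
    (Measurable.of_discrete (f := g)).comp hc
  have hIF : IndepFun (A.indicator fun _ => (1 : ℝ)) (fun ω => g (countEvents S E ω)) P := by
    rw [IndepFun_iff_Indep]
    exact indep_of_indep_of_le hindep hf.comap_le hg.comap_le
  have := hIF.integral_mul_eq_mul_integral
    ((measurable_const.indicator hA).aestronglyMeasurable)
    (integrable_comp_countEvents P hE g).aestronglyMeasurable
  simp only [Pi.mul_apply] at this
  rw [this, integral_indicator_const _ hA]
  simp

/-- A Stein–Chen bound for the probability that none of finitely many equiprobable events occurs,
where the law of the other events given `I x` is realised by the larger events `J x y`. -/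
theorem abs_measureReal_biInter_compl_sub_exp_le [MeasurableSpace Ω] (P : Measure Ω) [IsProbabilityMeasure P]
    [DecidableEq ι] {S : Finset ι} (hS : S.Nonempty) {I : ι → Set Ω} {J : ι → ι → Set Ω}
    (hI : ∀ x ∈ S, MeasurableSet (I x)) (hJ : ∀ x ∈ S, ∀ y ∈ S, MeasurableSet (J x y))
    (hIJ : ∀ x ∈ S, ∀ y ∈ S, I y ⊆ J x y) (hJI : ∀ x ∈ S, ∀ y ∈ S, I x ∩ J x y ⊆ I y)
    {p : ℝ} (hp : 0 < p) (hpI : ∀ x ∈ S, P.real (I x) = p)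
    (hind : ∀ x ∈ S, ∀ U ⊆ S.erase x,
      P.real (I x ∩ ⋂ y ∈ U, J x y) = P.real (I x) * P.real (⋂ y ∈ U, J x y))
    {ε : ℝ} (hε : ∀ x ∈ S, ∑ y ∈ S.erase x, (P.real (J x y) - p) + p ≤ ε) :
    |P.real (⋂ x ∈ S, (I x)ᶜ) - Real.exp (-(S.card * p))| ≤ ε := by
  have hN : (0 : ℝ) < S.card := by exact_mod_cast hS.card_pos
  set l : ℝ := S.card * p with hl
  have hl0 : 0 < l := by positivity
  set F := steinSol l
  set W := countEvents S I with hW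
  set V : ι → Ω → ℕ := fun x => countEvents (S.erase x) (J x) with hV
  have hJ' : ∀ x ∈ S, ∀ y ∈ S.erase x, MeasurableSet (J x y) := fun x hx y hy =>
    hJ x hx y (Finset.mem_of_mem_erase hy)
  -- On `I x` the events `J x y` and `I y` coincide, so the coupled count is W with x itself
  -- removed; this is the W - 1 of the Stein equation.
  have hVx : ∀ x ∈ S, ∀ ω ∈ I x, W ω - 1 = V x ω := by
    intro x hx ω hω
    classical
    have h1 : (S.filter fun y => ω ∈ I y).erase x = (S.erase x).filter fun y => ω ∈ J x y := by
      ext y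
      simp only [Finset.mem_erase, Finset.mem_filter]
      constructor
      · rintro ⟨h1, h2, h3⟩
        exact ⟨⟨h1, h2⟩, hIJ x hx y h2 h3⟩
      · rintro ⟨⟨h1, h2⟩, h3⟩
        exact ⟨h1, h2, hJI x hx y h2 ⟨hω, h3⟩⟩
    have h2 : x ∈ S.filter fun y => ω ∈ I y := Finset.mem_filter.2 ⟨hx, hω⟩
    rw [hW, hV]
    simp only [countEvents]
    rw [← Finset.card_erase_of_mem h2]
    convert congrArg Finset.card h1
  -- integrated Stein identity
  have hmain : Real.exp (-l) - P.real (⋂ x ∈ S, (I x)ᶜ) =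
      ∑ x ∈ S, p * (∫ ω, F (V x ω) ∂P - ∫ ω, F (W ω) ∂P) := by
    have hzero : MeasurableSet (⋂ x ∈ S, (I x)ᶜ) :=
      Finset.measurableSet_biInter S fun x hx => (hI x hx).compl
    have hpt : ∀ ω, Real.exp (-l) - (⋂ x ∈ S, (I x)ᶜ).indicator (fun _ => (1 : ℝ)) ω =
        ∑ x ∈ S, (I x).indicator (fun _ => (1 : ℝ)) ω * F (V x ω) - l * F (W ω) := by
      intro ω
      have h0 : (⋂ x ∈ S, (I x)ᶜ).indicator (fun _ => (1 : ℝ)) ω = 0 ^ W ω := by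
        have : ω ∈ (⋂ x ∈ S, (I x)ᶜ) ↔ W ω = 0 := by
          classical
          simp [hW, countEvents, Finset.filter_eq_empty_iff]
        by_cases h : W ω = 0
        · rw [Set.indicator_of_mem (this.2 h), h, pow_zero]
        · rw [Set.indicator_of_notMem (fun h' => h (this.1 h')), zero_pow h]
      rw [h0, ← steinSol_equation l (W ω), hW, countEvents_eq_sum, Finset.sum_mul]
      congr 1
      refine Finset.sum_congr rfl fun x hx => ?_
      by_cases h : ω ∈ I x
      · rw [← hVx x hx ω h]
      · simp [Set.indicator_of_notMem h]
    have hiF : ∀ x ∈ S, Integrable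
        (fun ω => (I x).indicator (fun _ => (1 : ℝ)) ω * F (V x ω)) P := by
      intro x hx
      have : (fun ω => (I x).indicator (fun _ => (1 : ℝ)) ω * F (V x ω)) =
          (I x).indicator (fun ω => F (V x ω)) := by
        ext ω; by_cases h : ω ∈ I x <;> simp [h]
      rw [this]
      exact (integrable_comp_countEvents P (hJ' x hx) F).indicator (hI x hx)
    have h1 := integral_congr_ae (μ := P) (Filter.Eventually.of_forall hpt)
    rw [integral_sub (integrable_const _) ((integrable_const _).indicator hzero),
      integral_indicator_const _ hzero,
      integral_sub (integrable_finsetSum _ hiF)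
        ((integrable_comp_countEvents P hI F).const_mul l),
      integral_finsetSum _ hiF, integral_const_mul] at h1
    simp only [integral_const, probReal_univ, smul_eq_mul, one_mul, mul_one] at h1
    rw [h1]
    have h2 : ∀ x ∈ S, ∫ ω, (I x).indicator (fun _ => (1 : ℝ)) ω * F (V x ω) ∂P =
        p * ∫ ω, F (V x ω) ∂P := by
      intro x hx
      rw [← hpI x hx]
      exact integral_indicator_mul_comp_countEvents P (hJ' x hx) (hI x hx) (hind x hx) F
    rw [Finset.sum_congr rfl h2]
    simp only [mul_sub, Finset.sum_sub_distrib, Finset.sum_const, nsmul_eq_mul]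
    rw [hl]; ring
  have hterm : ∀ x ∈ S, |∫ ω, F (V x ω) ∂P - ∫ ω, F (W ω) ∂P| ≤ ε * l⁻¹ := by
    intro x hx
    have hVi := integrable_comp_countEvents P (hJ' x hx) (fun k => (k : ℝ))
    have hWi := integrable_comp_countEvents P hI (fun k => (k : ℝ))
    have h1i : Integrable ((I x).indicator fun _ => (1 : ℝ)) P :=
      (integrable_const _).indicator (hI x hx)
    rw [← integral_sub (integrable_comp_countEvents P (hJ' x hx) F)
      (integrable_comp_countEvents P hI F), ← Real.norm_eq_abs]
    -- Monotonicity gives V ≥ W - 1_{I x}, hence |V - W| ≤ V - W + 2·1_{I x}, which can be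
    -- integrated without absolute values. The expectation of W includes the term p of x, so the 2p
    -- leaves the single p in `hε`.
    have hb : ∀ ω, ‖F (V x ω) - F (W ω)‖ ≤
        ((V x ω : ℝ) - W ω + 2 * (I x).indicator (fun _ => (1 : ℝ)) ω) * l⁻¹ := by
      intro ω
      refine (abs_steinSol_sub_le hl0 _ _).trans
        (mul_le_mul_of_nonneg_right ?_ (inv_nonneg.2 hl0.le))
      have hle : (W ω : ℝ) - (I x).indicator (fun _ => (1 : ℝ)) ω ≤ V x ω := by
        rw [hW, hV, countEvents_eq_sum, countEvents_eq_sum, ← Finset.sum_erase_eq_sub hx]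
        refine Finset.sum_le_sum fun y hy => ?_
        exact Set.indicator_le_indicator_of_subset (hIJ x hx y (Finset.mem_of_mem_erase hy))
          (fun _ => zero_le_one) ω
      have h0 : 0 ≤ (I x).indicator (fun _ => (1 : ℝ)) ω :=
        Set.indicator_nonneg (fun _ _ => zero_le_one) ω
      rw [abs_le]
      constructor <;> linarith
    have hbi : Integrable (fun ω => (V x ω : ℝ) - W ω +
        2 * (I x).indicator (fun _ => (1 : ℝ)) ω) P := (hVi.sub hWi).add (h1i.const_mul 2)
    have hVW : Integrable (fun ω => (V x ω : ℝ) - W ω) P := hVi.sub hWi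
    refine (norm_integral_le_of_norm_le (hbi.mul_const _)
      (Filter.Eventually.of_forall hb)).trans ?_
    rw [integral_mul_const]
    refine mul_le_mul_of_nonneg_right ?_ (inv_nonneg.2 hl0.le)
    have e : ∫ ω, ((V x ω : ℝ) - W ω + 2 * (I x).indicator (fun _ => (1 : ℝ)) ω) ∂P =
        ∫ ω, (V x ω : ℝ) ∂P - ∫ ω, (W ω : ℝ) ∂P + 2 * p := by
      rw [← hpI x hx, integral_add hVW (h1i.const_mul 2), integral_sub hVi hWi,
        integral_const_mul, integral_indicator_const _ (hI x hx)]
      simp [W, V]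
    rw [e]
    have e1 : ∫ ω, (V x ω : ℝ) ∂P = ∑ y ∈ S.erase x, P.real (J x y) :=
      integral_countEvents P (hJ' x hx)
    have e2 : ∫ ω, (W ω : ℝ) ∂P = ∑ y ∈ S, P.real (I y) := integral_countEvents P hI
    rw [e1, e2, ← Finset.add_sum_erase S _ hx, hpI x hx,
      Finset.sum_congr rfl fun y hy => hpI y (Finset.mem_of_mem_erase hy)]
    have := hε x hx
    rw [Finset.sum_sub_distrib] at this
    linarith
  rw [abs_sub_comm, hmain]
  refine (Finset.abs_sum_le_sum_abs _ _).trans ?_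
  calc ∑ x ∈ S, |p * (∫ ω, F (V x ω) ∂P - ∫ ω, F (W ω) ∂P)|
      ≤ ∑ x ∈ S, p * (ε * l⁻¹) := by
        refine Finset.sum_le_sum fun x hx => ?_
        rw [abs_mul, abs_of_pos hp]
        exact mul_le_mul_of_nonneg_left (hterm x hx) hp.le
    _ = ε := by
        rw [Finset.sum_const, nsmul_eq_mul, hl]
        field_simp

end SteinChen

/-! ### The invariant measure of lines hitting balls -/

variable {d : ℕ}

theorem mem_hitting_closedBall_iff (L : Line d) (x : Space d) (a : ℝ) :
    L ∈ hitting (closedBall x a) ↔ infDist x L.points ≤ a := by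
  have hne : L.points.Nonempty := L.2.1
  have hcl : IsClosed L.points := L.1.closed_of_finiteDimensional
  constructor
  · rintro ⟨y, hy, hya⟩
    refine (infDist_le_dist_of_mem hy).trans ?_
    rw [dist_comm]; exact hya
  · intro h
    obtain ⟨y, hy, hyd⟩ := hcl.exists_infDist_eq_dist hne x
    refine ⟨y, hy, ?_⟩
    rw [mem_closedBall, dist_comm, ← hyd]; exact h

/-- Moving x by ρ directly away from its projection q onto L gives a point of the ball at distance
‖x - q‖ + ρ from L, which must be at most 1; the converse is the triangle inequality. -/
theorem closedBall_subset_cylinder_iff (L : Line d) (x : Space d) {ρ : ℝ} (h0 : 0 ≤ ρ)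
    (h1 : ρ ≤ 1) :
    closedBall x ρ ⊆ cylinder L ↔ L ∈ hitting (closedBall x (1 - ρ)) := by
  rw [mem_hitting_closedBall_iff]
  have hne : L.points.Nonempty := L.2.1
  constructor
  · intro h
    have : Nonempty L.1 := hne.to_subtype
    set q : Space d := (EuclideanGeometry.orthogonalProjection L.1 x).1 with hq
    have hqL : q ∈ L.points := EuclideanGeometry.orthogonalProjection_mem x
    by_cases hx : x = q
    · rw [infDist_zero_of_mem (hx ▸ hqL)]; linarith
    have hpos : 0 < ‖x - q‖ := norm_pos_iff.2 (sub_ne_zero.2 hx)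
    set w : Space d := x + (ρ / ‖x - q‖) • (x - q) with hw
    have hwx : w ∈ closedBall x ρ := by
      rw [mem_closedBall, hw, dist_eq_norm, add_sub_cancel_left, norm_smul, Real.norm_eq_abs,
        abs_of_nonneg (by positivity), div_mul_cancel₀ _ hpos.ne']
    have hwc : infDist w L.points ≤ 1 := h hwx
    have hort : ∀ y ∈ L.points, inner ℝ (x - q) (q - y) = 0 := by
      intro y hy
      have h2 := EuclideanGeometry.vsub_orthogonalProjection_mem_direction_orthogonal L.1 x
      rw [Submodule.mem_orthogonal'] at h2
      exact h2 (q - y) (AffineSubspace.vsub_mem_direction hqL hy)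
    have hwd : ‖x - q‖ + ρ ≤ infDist w L.points := by
      refine (le_infDist hne).2 fun y hy => ?_
      rw [dist_eq_norm]
      have e1 : w - y = (1 + ρ / ‖x - q‖) • (x - q) + (q - y) := by
        rw [hw]; module
      have e2 : ‖w - y‖ ^ 2 = ((1 + ρ / ‖x - q‖) * ‖x - q‖) ^ 2 + ‖q - y‖ ^ 2 := by
        rw [e1, norm_add_sq_real, inner_smul_left, hort y hy, norm_smul, mul_pow, mul_pow]
        simp
      have e3 : (1 + ρ / ‖x - q‖) * ‖x - q‖ = ‖x - q‖ + ρ := by field_simp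
      rw [e3] at e2
      refine le_of_sq_le_sq ?_ (norm_nonneg _)
      nlinarith [sq_nonneg ‖q - y‖]
    have := infDist_le_dist_of_mem (x := x) hqL
    rw [dist_eq_norm] at this
    linarith
  · intro h y hy
    have := infDist_le_infDist_add_dist (s := L.points) (x := y) (y := x)
    rw [mem_closedBall] at hy
    change infDist y L.points ≤ 1
    linarith

/-- A line of direction u is a single point of the hyperplane orthogonal to u, and a ball is seen
there as its projection. All measures of lines below thereby become averages over u of volumes in
dimension d - 1. -/
theorem setOf_lineThrough_mem_hitting_closedBall (u : sphere (0 : Space d) 1) (x : Space d)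
    (a : ℝ) :
    {y : (ℝ ∙ (u : Space d))ᗮ | lineThrough u (y : Space d) ∈ hitting (closedBall x a)} =
      closedBall ((ℝ ∙ (u : Space d))ᗮ.orthogonalProjectionOnto x) a := by
  set V : Submodule ℝ (Space d) := (ℝ ∙ (u : Space d)) with hV
  ext y
  have hPy : Vᗮ.orthogonalProjectionOnto (y : Space d) = y :=
    Submodule.orthogonalProjectionOnto_mem_subspace_eq_self y
  have hPu : Vᗮ.orthogonalProjectionOnto (u : Space d) = 0 := by
    rw [Submodule.orthogonalProjectionOnto_eq_zero_iff, Submodule.orthogonal_orthogonal]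
    exact Submodule.mem_span_singleton_self _
  simp only [Set.mem_ofPred_eq, mem_closedBall]
  constructor
  · rintro ⟨z, hz, hza⟩
    obtain ⟨t, rfl⟩ := (mem_points_lineThrough _ _ _).1 hz
    rw [mem_closedBall, dist_eq_norm] at hza
    have h1 := Vᗮ.norm_orthogonalProjectionOnto_apply_le ((y : Space d) + t • (u : Space d) - x)
    rw [map_sub, map_add, map_smul, hPy, hPu, smul_zero, add_zero] at h1
    rw [dist_eq_norm]
    exact h1.trans hza
  · intro h
    have h2 : x - (Vᗮ.orthogonalProjectionOnto x : Space d) ∈ V := by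
      have := Vᗮ.sub_starProjection_mem_orthogonal x
      rwa [Submodule.orthogonal_orthogonal] at this
    obtain ⟨t, ht⟩ := Submodule.mem_span_singleton.1 h2
    refine ⟨(y : Space d) + t • (u : Space d), (mem_points_lineThrough _ _ _).2 ⟨t, rfl⟩, ?_⟩
    rw [mem_closedBall, dist_eq_norm, ht]
    rw [dist_eq_norm] at h
    have : (y : Space d) + (x - (Vᗮ.orthogonalProjectionOnto x : Space d)) - x =
        ((y - Vᗮ.orthogonalProjectionOnto x : Vᗮ) : Space d) := by
      push_cast; abel
    rw [this]
    exact h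

theorem finrank_span_singleton_orthogonal (u : sphere (0 : Space d) 1) :
    Module.finrank ℝ (ℝ ∙ (u : Space d))ᗮ = d - 1 := by
  have := (ℝ ∙ (u : Space d)).finrank_add_finrank_orthogonal
  rw [finrank_span_singleton (ne_zero_of_mem_unit_sphere u), finrank_euclideanSpace_fin] at this
  omega

theorem volume_closedBall_span_singleton_orthogonal (hd : 2 ≤ d) (u : sphere (0 : Space d) 1)
    (c : (ℝ ∙ (u : Space d))ᗮ) {a : ℝ} (ha : 0 ≤ a) :
    volume (closedBall c a) = ENNReal.ofReal (a ^ (d - 1)) * unitBallVolume (d - 1) := by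
  have hf := finrank_span_singleton_orthogonal u
  have : Nontrivial (ℝ ∙ (u : Space d))ᗮ := Module.nontrivial_of_finrank_pos (R := ℝ) (by omega)
  have : Nonempty (Fin (d - 1)) := ⟨⟨0, by omega⟩⟩
  rw [unitBallVolume, InnerProductSpace.volume_closedBall, InnerProductSpace.volume_closedBall, hf,
    finrank_euclideanSpace_fin, ENNReal.ofReal_pow ha]
  simp

theorem unitBallVolume_ne_zero (n : ℕ) : unitBallVolume n ≠ 0 :=
  (measure_closedBall_pos _ _ one_pos).ne'

theorem unitBallVolume_ne_top (n : ℕ) : unitBallVolume n ≠ ∞ :=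
  (isCompact_closedBall _ _).measure_ne_top

theorem sphereMeasure_univ (hd : 2 ≤ d) : sphereMeasure d Set.univ = 1 := by
  have hne : Nonempty (Fin d) := ⟨⟨0, by omega⟩⟩
  rw [sphereMeasure, Measure.smul_apply, smul_eq_mul]
  refine ENNReal.inv_mul_cancel ?_ (measure_ne_top _ _)
  rw [Ne, Measure.measure_univ_eq_zero]
  exact Measure.toSphere_ne_zero _

theorem measurableSet_hitting_closedBall (x : Space d) (a : ℝ) :
    MeasurableSet (hitting (closedBall x a) : Set (Line d)) :=
  measurableSet_hitting (isCompact_closedBall _ _)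

theorem lineMeasure_hitting_closedBall (hd : 2 ≤ d) (x : Space d) {a : ℝ} (ha : 0 ≤ a) :
    lineMeasure d (hitting (closedBall x a)) = ENNReal.ofReal (a ^ (d - 1)) := by
  rw [lineMeasure_apply d (measurableSet_hitting_closedBall x a)]
  simp_rw [setOf_lineThrough_mem_hitting_closedBall,
    volume_closedBall_span_singleton_orthogonal hd _ _ ha]
  rw [lintegral_const, sphereMeasure_univ hd, mul_one, mul_comm (ENNReal.ofReal _), ← mul_assoc,
    ENNReal.inv_mul_cancel (unitBallVolume_ne_zero _) (unitBallVolume_ne_top _), one_mul]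

theorem lineMeasure_hitting_diff (x y : Space d) (a : ℝ) :
    lineMeasure d (hitting (closedBall x a) \ hitting (closedBall y a)) =
      (unitBallVolume (d - 1))⁻¹ * ∫⁻ u, volume
        (closedBall ((ℝ ∙ (u : Space d))ᗮ.orthogonalProjectionOnto x) a \
          closedBall ((ℝ ∙ (u : Space d))ᗮ.orthogonalProjectionOnto y) a) ∂(sphereMeasure d) := by
  rw [lineMeasure_apply d ((measurableSet_hitting_closedBall x a).diff
    (measurableSet_hitting_closedBall y a))]
  congr 1
  refine lintegral_congr fun u => ?_
  rw [← setOf_lineThrough_mem_hitting_closedBall, ← setOf_lineThrough_mem_hitting_closedBall]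
  rfl

theorem lineMeasure_hitting_inter (x y : Space d) (a : ℝ) :
    lineMeasure d (hitting (closedBall x a) ∩ hitting (closedBall y a)) =
      (unitBallVolume (d - 1))⁻¹ * ∫⁻ u, volume
        (closedBall ((ℝ ∙ (u : Space d))ᗮ.orthogonalProjectionOnto x) a ∩
          closedBall ((ℝ ∙ (u : Space d))ᗮ.orthogonalProjectionOnto y) a) ∂(sphereMeasure d) := by
  rw [lineMeasure_apply d ((measurableSet_hitting_closedBall x a).inter
    (measurableSet_hitting_closedBall y a))]
  congr 1
  refine lintegral_congr fun u => ?_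
  rw [← setOf_lineThrough_mem_hitting_closedBall, ← setOf_lineThrough_mem_hitting_closedBall]
  rfl

/-- Projections are linear and volume on each hyperplane is translation invariant. -/
theorem lineMeasure_hitting_diff_add (x y w : Space d) (a : ℝ) :
    lineMeasure d (hitting (closedBall (x + w) a) \ hitting (closedBall (y + w) a)) =
      lineMeasure d (hitting (closedBall x a) \ hitting (closedBall y a)) := by
  rw [lineMeasure_hitting_diff, lineMeasure_hitting_diff]
  congr 1
  refine lintegral_congr fun u => ?_
  set q := (ℝ ∙ (u : Space d))ᗮ.orthogonalProjectionOnto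
  rw [map_add, map_add, ← measure_preimage_add_right volume (q w)]
  congr 1
  ext z
  simp

/-- A line that meets the first ball and misses the n-th translate is lost at one of the n steps,
and all steps have the same measure. Thus a lower bound for a long displacement yields one for a
short displacement. -/
theorem lineMeasure_hitting_diff_nsmul_le (x v : Space d) (a : ℝ) (n : ℕ) :
    lineMeasure d (hitting (closedBall x a) \ hitting (closedBall (x + n • v) a)) ≤
      n * lineMeasure d (hitting (closedBall x a) \ hitting (closedBall (x + v) a)) := by
  induction n with
  | zero => simp
  | succ n ih =>
    have h : (hitting (closedBall x a) \ hitting (closedBall (x + (n + 1) • v) a) : Set (Line d)) ⊆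
        (hitting (closedBall x a) \ hitting (closedBall (x + n • v) a)) ∪
        (hitting (closedBall (x + n • v) a) \ hitting (closedBall (x + v + n • v) a)) := by
      rintro L ⟨h1, h2⟩
      have e : x + (n + 1) • v = x + v + n • v := by rw [add_smul, one_smul]; abel
      rw [e] at h2
      by_cases h3 : L ∈ hitting (closedBall (x + n • v) a)
      · exact Or.inr ⟨h3, h2⟩
      · exact Or.inl ⟨h1, h3⟩
    refine (measure_mono h).trans ((measure_union_le _ _).trans ?_)
    rw [lineMeasure_hitting_diff_add]
    push_cast
    rw [add_mul, one_mul]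
    gcongr

/-! ### Spherical caps, and lines that meet one or both of two balls -/

/-- The uniform measure of a set of directions is the relative volume of the cone over it. -/
theorem sphereMeasure_apply (hd : 2 ≤ d) {s : Set (sphere (0 : Space d) 1)}
    (hs : MeasurableSet s) :
    sphereMeasure d s = (volume (ball (0 : Space d) 1))⁻¹ *
      volume (Set.Ioo (0 : ℝ) 1 • ((↑) '' s : Set (Space d))) := by
  rw [sphereMeasure, Measure.smul_apply, smul_eq_mul, Measure.toSphere_apply_univ,
    Measure.toSphere_apply' _ hs, finrank_euclideanSpace_fin]
  have h0 : (d : ℝ≥0∞) ≠ 0 := by exact_mod_cast (by omega : d ≠ 0)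
  have h1 : (d : ℝ≥0∞) ≠ ∞ := ENNReal.natCast_ne_top d
  rw [ENNReal.mul_inv (Or.inl h0) (Or.inl h1), mul_mul_mul_comm, ENNReal.inv_mul_cancel h0 h1,
    one_mul]

theorem exists_unit_orthogonal (hd : 2 ≤ d) {e : Space d} (he : ‖e‖ = 1) :
    ∃ f : Space d, ‖f‖ = 1 ∧ inner ℝ e f = 0 := by
  have hf := finrank_span_singleton_orthogonal (d := d) ⟨e, by simpa using he⟩
  have : Nontrivial (ℝ ∙ e)ᗮ := Module.nontrivial_of_finrank_pos (R := ℝ) (by simp at hf; omega)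
  obtain ⟨g, hg⟩ := exists_ne (0 : (ℝ ∙ e)ᗮ)
  have hg' : (g : Space d) ≠ 0 := fun h => hg (Subtype.ext h)
  refine ⟨(‖(g : Space d)‖⁻¹ : ℝ) • (g : Space d), ?_, ?_⟩
  · exact norm_smul_inv_norm hg'
  · rw [inner_smul_right, Submodule.mem_orthogonal_singleton_iff_inner_right.1 g.2, mul_zero]

theorem inner_sq_add_inner_sq_le {x e f : Space d} (he : ‖e‖ = 1) (hf : ‖f‖ = 1)
    (hef : inner ℝ e f = 0) : inner ℝ x e ^ 2 + inner ℝ x f ^ 2 ≤ ‖x‖ ^ 2 := by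
  have h : ‖x - inner ℝ x e • e - inner ℝ x f • f‖ ^ 2 =
      ‖x‖ ^ 2 - inner ℝ x e ^ 2 - inner ℝ x f ^ 2 := by
    rw [norm_sub_sq_real, norm_sub_sq_real, inner_sub_left, inner_smul_left, inner_smul_right,
      inner_smul_right, inner_smul_right, norm_smul, norm_smul, he, hf, hef]
    simp
    ring
  nlinarith [sq_nonneg ‖x - inner ℝ x e • e - inner ℝ x f • f‖]

/-- The directions whose angle with `e` is less than `π / 4` form at most half of the sphere. -/
theorem sphereMeasure_half_lt_inner_sq_le (hd : 2 ≤ d) {e : Space d} (he : ‖e‖ = 1) :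
    sphereMeasure d {u | 1 / 2 < inner ℝ (u : Space d) e ^ 2} ≤ 1 / 2 := by
  have hcone : ∀ g : Space d, Set.Ioo (0 : ℝ) 1 • ((↑) '' {u : sphere (0 : Space d) 1 |
      1 / 2 < inner ℝ (u : Space d) g ^ 2} : Set (Space d)) =
      {x | x ∈ ball (0 : Space d) 1 ∧ ‖x‖ ^ 2 / 2 < inner ℝ x g ^ 2} := by
    intro g
    ext x
    rw [Set.mem_smul]
    constructor
    · rintro ⟨r, hr, _, ⟨u, hu, rfl⟩, rfl⟩
      have hu1 : ‖(u : Space d)‖ = 1 := norm_eq_of_mem_sphere u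
      refine ⟨?_, ?_⟩
      · rw [mem_ball_zero_iff, norm_smul, hu1, mul_one, Real.norm_eq_abs, abs_of_pos hr.1]
        exact hr.2
      · rw [norm_smul, inner_smul_left, hu1, mul_one, Real.norm_eq_abs, sq_abs]
        have : (1 : ℝ) / 2 < inner ℝ (u : Space d) g ^ 2 := hu
        simp only [conj_trivial, mul_pow]
        nlinarith [pow_pos hr.1 2]
    · rintro ⟨hx1, hx2⟩
      have hx0 : x ≠ 0 := by rintro rfl; simp at hx2
      have hpos : 0 < ‖x‖ := norm_pos_iff.2 hx0
      refine ⟨‖x‖, ⟨hpos, mem_ball_zero_iff.1 hx1⟩, ‖x‖⁻¹ • x,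
        ⟨⟨‖x‖⁻¹ • x, ?_⟩, ?_, rfl⟩, ?_⟩
      · rw [mem_sphere_zero_iff_norm]; exact norm_smul_inv_norm hx0
      · change (1 : ℝ) / 2 < inner ℝ (‖x‖⁻¹ • x) g ^ 2
        rw [inner_smul_left, conj_trivial, mul_pow, inv_pow, inv_mul_eq_div,
          lt_div_iff₀ (by positivity)]
        linarith
      · exact smul_inv_smul₀ hpos.ne' x
  have hmeas : ∀ g : Space d, MeasurableSet {u : sphere (0 : Space d) 1 |
      1 / 2 < inner ℝ (u : Space d) g ^ 2} := fun g =>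
    (isOpen_lt continuous_const (by fun_prop)).measurableSet
  obtain ⟨f, hf, hef⟩ := exists_unit_orthogonal hd he
  have hefeq : sphereMeasure d {u | 1 / 2 < inner ℝ (u : Space d) e ^ 2} =
      sphereMeasure d {u | 1 / 2 < inner ℝ (u : Space d) f ^ 2} := by
    rw [sphereMeasure_apply hd (hmeas e), sphereMeasure_apply hd (hmeas f), hcone, hcone]
    congr 1
    -- The reflection exchanging e and f maps one double cap onto the other, so the two have equal
    -- measure.
    set T := Submodule.reflection (ℝ ∙ (f - e))ᗮ with hT
    have hTf : T f = e := Submodule.reflection_sub (by rw [he, hf])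
    have hm : MeasurableSet {x : Space d | x ∈ ball (0 : Space d) 1 ∧
        ‖x‖ ^ 2 / 2 < inner ℝ x e ^ 2} := by
      have h : IsOpen {x : Space d | ‖x‖ ^ 2 / 2 < inner ℝ x e ^ 2} :=
        isOpen_lt (by fun_prop) (by fun_prop)
      exact isOpen_ball.measurableSet.inter h.measurableSet
    rw [← T.measurePreserving.measure_preimage hm.nullMeasurableSet]
    congr 1
    ext x
    simp only [Set.mem_preimage, Set.mem_ofPred_eq, mem_ball_zero_iff, T.norm_map]
    rw [← hTf, T.inner_map_map]
  -- By Bessel's inequality the two squared inner products sum to at most 1, so both cannot exceed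
  -- 1/2; two disjoint sets of equal measure have measure at most 1/2 each.
  have hdisj : Disjoint {u : sphere (0 : Space d) 1 | 1 / 2 < inner ℝ (u : Space d) e ^ 2}
      {u | 1 / 2 < inner ℝ (u : Space d) f ^ 2} := by
    rw [Set.disjoint_left]
    intro u h1 h2
    have h3 := inner_sq_add_inner_sq_le (x := (u : Space d)) he hf hef
    rw [norm_eq_of_mem_sphere u] at h3
    have h1' : (1 : ℝ) / 2 < inner ℝ (u : Space d) e ^ 2 := h1
    have h2' : (1 : ℝ) / 2 < inner ℝ (u : Space d) f ^ 2 := h2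
    linarith
  have hsum := measure_union (μ := sphereMeasure d) hdisj (hmeas f)
  rw [← hefeq] at hsum
  have hle : 2 * sphereMeasure d {u | 1 / 2 < inner ℝ (u : Space d) e ^ 2} ≤ 1 := by
    rw [two_mul, ← hsum, ← sphereMeasure_univ hd]
    exact measure_mono (Set.subset_univ _)
  rwa [ENNReal.le_div_iff_mul_le (by norm_num) (by norm_num), mul_comm]

theorem norm_orthogonalProjectionOnto_sq (u : sphere (0 : Space d) 1) (v : Space d) :
    ‖(ℝ ∙ (u : Space d))ᗮ.orthogonalProjectionOnto v‖ ^ 2 = ‖v‖ ^ 2 - inner ℝ (u : Space d) v ^ 2 := by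
  have hu : ‖(u : Space d)‖ = 1 := norm_eq_of_mem_sphere u
  have h := Submodule.norm_sq_eq_add_norm_sq_projection v (ℝ ∙ (u : Space d))
  have h2 : ‖(ℝ ∙ (u : Space d)).orthogonalProjectionOnto v‖ ^ 2 = inner ℝ (u : Space d) v ^ 2 := by
    rw [← Submodule.norm_coe, Submodule.coe_orthogonalProjectionOnto_apply,
      Submodule.starProjection_unit_singleton ℝ hu, norm_smul, hu, mul_one, Real.norm_eq_abs,
      sq_abs]
  linarith

theorem norm_orthogonalProjectionOnto_sq_of_smul (u : sphere (0 : Space d) 1) {v : Space d}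
    (hv : v ≠ 0) : ‖(ℝ ∙ (u : Space d))ᗮ.orthogonalProjectionOnto v‖ ^ 2 =
      ‖v‖ ^ 2 * (1 - inner ℝ (u : Space d) (‖v‖⁻¹ • v) ^ 2) := by
  have hpos : 0 < ‖v‖ := norm_pos_iff.2 hv
  rw [norm_orthogonalProjectionOnto_sq, inner_smul_right]
  field_simp

/-- At least half of the lines that meet a ball miss a given far ball of the same radius. -/
theorem le_lineMeasure_hitting_diff (hd : 2 ≤ d) (x : Space d) {v : Space d} (hv : 3 ≤ ‖v‖)
    {a : ℝ} (ha0 : 0 ≤ a) (ha1 : a ≤ 1) :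
    ENNReal.ofReal (a ^ (d - 1)) * 2⁻¹ ≤
      lineMeasure d (hitting (closedBall x a) \ hitting (closedBall (x + v) a)) := by
  have hv0 : v ≠ 0 := by rintro rfl; simp at hv; linarith
  set e : Space d := ‖v‖⁻¹ • v with he
  have he1 : ‖e‖ = 1 := norm_smul_inv_norm hv0
  set G : Set (sphere (0 : Space d) 1) := {u | 1 / 2 < inner ℝ (u : Space d) e ^ 2} with hG
  have hGm : MeasurableSet G := (isOpen_lt continuous_const (by fun_prop)).measurableSet
  have hprob : IsProbabilityMeasure (sphereMeasure d) := ⟨sphereMeasure_univ hd⟩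
  have hGc : 2⁻¹ ≤ sphereMeasure d Gᶜ := by
    rw [prob_compl_eq_one_sub hGm]
    have h := sphereMeasure_half_lt_inner_sq_le hd he1
    calc (2⁻¹ : ℝ≥0∞) = 1 - 1 / 2 := by rw [one_div, ENNReal.one_sub_inv_two]
      _ ≤ _ := tsub_le_tsub_left h 1
  rw [lineMeasure_hitting_diff]
  have hint : ENNReal.ofReal (a ^ (d - 1)) * unitBallVolume (d - 1) * sphereMeasure d Gᶜ ≤
      ∫⁻ u, volume (closedBall ((ℝ ∙ (u : Space d))ᗮ.orthogonalProjectionOnto x) a \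
          closedBall ((ℝ ∙ (u : Space d))ᗮ.orthogonalProjectionOnto (x + v)) a)
          ∂(sphereMeasure d) := by
    rw [← lintegral_indicator_const hGm.compl]
    refine lintegral_mono fun u => ?_
    by_cases hu : u ∈ Gᶜ
    · rw [Set.indicator_of_mem hu]
      -- Outside G the projected displacement has squared norm at least 9/2, more than 4 ≥ (2a)².
      have hdis : Disjoint (closedBall ((ℝ ∙ (u : Space d))ᗮ.orthogonalProjectionOnto x) a)
          (closedBall ((ℝ ∙ (u : Space d))ᗮ.orthogonalProjectionOnto (x + v)) a) := by
        refine closedBall_disjoint_closedBall ?_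
        rw [map_add, dist_self_add_right]
        have h1 := norm_orthogonalProjectionOnto_sq_of_smul u hv0
        have h2 : inner ℝ (u : Space d) (‖v‖⁻¹ • v) ^ 2 ≤ 1 / 2 := not_lt.1 hu
        refine lt_of_pow_lt_pow_left₀ 2 (norm_nonneg _) ?_
        rw [h1]
        nlinarith [sq_nonneg ‖v‖]
      rw [sdiff_eq_left.2 hdis, volume_closedBall_span_singleton_orthogonal hd u _ ha0]
    · rw [Set.indicator_of_notMem hu]; exact zero_le
  calc ENNReal.ofReal (a ^ (d - 1)) * 2⁻¹
      = (unitBallVolume (d - 1))⁻¹ *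
        (ENNReal.ofReal (a ^ (d - 1)) * unitBallVolume (d - 1) * 2⁻¹) := by
        rw [mul_comm (ENNReal.ofReal _) (unitBallVolume _), mul_assoc,
          ← mul_assoc (unitBallVolume (d - 1))⁻¹,
          ENNReal.inv_mul_cancel (unitBallVolume_ne_zero _) (unitBallVolume_ne_top _), one_mul]
    _ ≤ _ := by gcongr; exact le_trans (by gcongr) hint

/-- The uniform measure of a double spherical cap. -/
theorem sphereMeasure_cap_le (hd : 2 ≤ d) {e : Space d} (he : ‖e‖ = 1) {ε : ℝ} (h0 : 0 < ε)
    (h1 : ε ≤ 1) :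
    sphereMeasure d {u | 1 - inner ℝ (u : Space d) e ^ 2 ≤ ε ^ 2} ≤
      ENNReal.ofReal (5 * 2 ^ d * ε ^ (d - 1)) := by
  have hm : MeasurableSet {u : sphere (0 : Space d) 1 | 1 - inner ℝ (u : Space d) e ^ 2 ≤ ε ^ 2} :=
    (isClosed_le (by fun_prop) continuous_const).measurableSet
  rw [sphereMeasure_apply hd hm]
  set M : ℕ := ⌈1 / ε⌉₊ with hM
  have hMle : 1 / ε ≤ M := Nat.le_ceil _
  have hMlt : (M : ℝ) < 1 / ε + 1 := Nat.ceil_lt_add_one (by positivity)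
  -- The cone over the double cap lies within ε of the segment from -e to e, hence in 2M + 1 balls
  -- of radius 2ε centred at multiples of εe. Since (2M + 1)ε ≤ 2 + 3ε ≤ 5, the relative volume is
  -- at most 5·2^d ε^{d-1}.
  have hsub : (Set.Ioo (0 : ℝ) 1 • ((↑) '' {u : sphere (0 : Space d) 1 |
      1 - inner ℝ (u : Space d) e ^ 2 ≤ ε ^ 2} : Set (Space d))) ⊆
      ⋃ k ∈ Finset.Icc (-(M : ℤ)) M, ball (((k : ℝ) * ε) • e) (2 * ε) := by
    intro x hx
    obtain ⟨r, hr, _, ⟨u, hu, rfl⟩, rfl⟩ := Set.mem_smul.1 hx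
    have hu1 : ‖(u : Space d)‖ = 1 := norm_eq_of_mem_sphere u
    have hu2 : 1 - inner ℝ (u : Space d) e ^ 2 ≤ ε ^ 2 := hu
    set c : ℝ := inner ℝ (u : Space d) e with hc
    have hperp : ‖(u : Space d) - c • e‖ ≤ ε := by
      have h2 : ‖(u : Space d) - c • e‖ ^ 2 = 1 - c ^ 2 := by
        rw [norm_sub_sq_real, inner_smul_right, norm_smul, he, hu1, ← hc]
        simp; ring
      exact le_of_sq_le_sq (by rw [h2]; exact hu2) h0.le
    have hcle : |c| ≤ 1 := by
      have := abs_real_inner_le_norm (u : Space d) e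
      rwa [he, hu1, one_mul] at this
    set k : ℤ := ⌊r * c / ε⌋ with hk
    have hrc : |r * c| ≤ 1 := by
      rw [abs_mul, abs_of_pos hr.1]
      nlinarith [abs_nonneg c, hr.2, hr.1]
    have hrce : |r * c / ε| ≤ M := by
      rw [abs_div, abs_of_pos h0]
      exact (div_le_div_of_nonneg_right hrc h0.le).trans hMle
    have hkM : k ∈ Finset.Icc (-(M : ℤ)) M := by
      rw [Finset.mem_Icc]
      constructor
      · rw [hk, Int.le_floor]; push_cast; exact (abs_le.1 hrce).1
      · have := (Int.floor_le (r * c / ε)).trans (abs_le.1 hrce).2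
        exact_mod_cast this
    refine Set.mem_biUnion hkM ?_
    rw [mem_ball, dist_eq_norm]
    have hkd : |r * c - k * ε| < ε := by
      have e1 : r * c - k * ε = (r * c / ε - k) * ε := by field_simp
      rw [e1, abs_mul, abs_of_pos h0, abs_of_nonneg (by linarith [Int.floor_le (r * c / ε)])]
      have := Int.lt_floor_add_one (r * c / ε)
      nlinarith
    have e2 : r • (u : Space d) - ((k : ℝ) * ε) • e =
        r • ((u : Space d) - c • e) + (r * c - k * ε) • e := by module
    rw [e2]
    have h3 : ‖r • ((u : Space d) - c • e)‖ ≤ ε := by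
      rw [norm_smul, Real.norm_eq_abs, abs_of_pos hr.1]
      nlinarith [norm_nonneg ((u : Space d) - c • e), hr.1, hr.2]
    have h4 : ‖(r * c - k * ε) • e‖ < ε := by
      rw [norm_smul, he, mul_one]; exact hkd
    linarith [norm_add_le (r • ((u : Space d) - c • e)) ((r * c - k * ε) • e)]
  have hball : ∀ z : Space d, volume (ball z (2 * ε)) =
      ENNReal.ofReal ((2 * ε) ^ d) * volume (ball (0 : Space d) 1) := by
    intro z
    rw [Measure.addHaar_ball_of_pos _ _ (by positivity), finrank_euclideanSpace_fin]
  have hvol : volume (Set.Ioo (0 : ℝ) 1 • ((↑) '' {u : sphere (0 : Space d) 1 |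
      1 - inner ℝ (u : Space d) e ^ 2 ≤ ε ^ 2} : Set (Space d))) ≤
      ENNReal.ofReal (5 * 2 ^ d * ε ^ (d - 1)) * volume (ball (0 : Space d) 1) := by
    refine (measure_mono hsub).trans ((measure_biUnion_finset_le _ _).trans ?_)
    simp_rw [hball]
    rw [Finset.sum_const, Int.card_Icc, nsmul_eq_mul, ← mul_assoc]
    refine mul_le_mul' ?_ le_rfl
    have e1 : ((M : ℤ) + 1 - -(M : ℤ)).toNat = 2 * M + 1 := by omega
    rw [e1, ← ENNReal.ofReal_natCast, ← ENNReal.ofReal_mul (by positivity)]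
    refine ENNReal.ofReal_le_ofReal ?_
    push_cast
    obtain ⟨m, rfl⟩ : ∃ m, d = m + 1 := ⟨d - 1, by omega⟩
    have h5 : (2 * (M : ℝ) + 1) * ε ≤ 5 := by
      have : (1 / ε) * ε = 1 := by field_simp
      nlinarith
    calc (2 * (M : ℝ) + 1) * (2 * ε) ^ (m + 1)
        = ((2 * (M : ℝ) + 1) * ε) * (2 ^ (m + 1) * ε ^ m) := by rw [mul_pow, pow_succ ε]; ring
      _ ≤ 5 * (2 ^ (m + 1) * ε ^ m) := by gcongr
      _ = 5 * 2 ^ (m + 1) * ε ^ (m + 1 - 1) := by rw [Nat.add_sub_cancel]; ring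
  calc _ ≤ (volume (ball (0 : Space d) 1))⁻¹ *
        (ENNReal.ofReal (5 * 2 ^ d * ε ^ (d - 1)) * volume (ball (0 : Space d) 1)) := by gcongr
    _ = _ := by
      rw [mul_comm, mul_assoc, ENNReal.mul_inv_cancel (measure_ball_pos _ _ one_pos).ne'
        measure_ball_lt_top.ne, mul_one]

/-- The lines that meet two distant balls. -/
theorem lineMeasure_hitting_inter_le (hd : 2 ≤ d) (x : Space d) {v : Space d} (hv : 2 ≤ ‖v‖)
    {a : ℝ} (ha0 : 0 ≤ a) (ha1 : a ≤ 1) :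
    lineMeasure d (hitting (closedBall x a) ∩ hitting (closedBall (x + v) a)) ≤
      ENNReal.ofReal (a ^ (d - 1)) * ENNReal.ofReal (5 * 2 ^ d * (2 / ‖v‖) ^ (d - 1)) := by
  have hv0 : v ≠ 0 := by rintro rfl; simp at hv; linarith
  have hpos : 0 < ‖v‖ := norm_pos_iff.2 hv0
  set e : Space d := ‖v‖⁻¹ • v with he
  have he1 : ‖e‖ = 1 := norm_smul_inv_norm hv0
  set G : Set (sphere (0 : Space d) 1) :=
    {u | 1 - inner ℝ (u : Space d) e ^ 2 ≤ (2 / ‖v‖) ^ 2} with hG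
  have hGm : MeasurableSet G := (isClosed_le (by fun_prop) continuous_const).measurableSet
  have hcap : sphereMeasure d G ≤ _ :=
    sphereMeasure_cap_le hd he1 (by positivity) ((div_le_one hpos).2 hv)
  rw [lineMeasure_hitting_inter]
  have hint : ∫⁻ u, volume (closedBall ((ℝ ∙ (u : Space d))ᗮ.orthogonalProjectionOnto x) a ∩
          closedBall ((ℝ ∙ (u : Space d))ᗮ.orthogonalProjectionOnto (x + v)) a)
          ∂(sphereMeasure d) ≤
      ENNReal.ofReal (a ^ (d - 1)) * unitBallVolume (d - 1) * sphereMeasure d G := by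
    rw [← lintegral_indicator_const hGm]
    refine lintegral_mono fun u => ?_
    by_cases hu : u ∈ G
    · rw [Set.indicator_of_mem hu, ← volume_closedBall_span_singleton_orthogonal hd u
        ((ℝ ∙ (u : Space d))ᗮ.orthogonalProjectionOnto x) ha0]
      exact measure_mono Set.inter_subset_left
    · rw [Set.indicator_of_notMem hu]
      -- The cap radius 2/‖v‖ is chosen so that outside the cap the projected centres are more than
      -- 2 ≥ 2a apart.
      have hdis : Disjoint (closedBall ((ℝ ∙ (u : Space d))ᗮ.orthogonalProjectionOnto x) a)
          (closedBall ((ℝ ∙ (u : Space d))ᗮ.orthogonalProjectionOnto (x + v)) a) := by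
        refine closedBall_disjoint_closedBall ?_
        rw [map_add, dist_self_add_right]
        have h1 := norm_orthogonalProjectionOnto_sq_of_smul u hv0
        have h2 : (2 / ‖v‖) ^ 2 < 1 - inner ℝ (u : Space d) (‖v‖⁻¹ • v) ^ 2 := not_le.1 hu
        rw [div_pow, div_lt_iff₀ (by positivity)] at h2
        refine lt_of_pow_lt_pow_left₀ 2 (norm_nonneg _) ?_
        rw [h1]
        nlinarith [sq_nonneg ‖v‖]
      rw [hdis.inter_eq, measure_empty]
  calc _ ≤ (unitBallVolume (d - 1))⁻¹ *
        (ENNReal.ofReal (a ^ (d - 1)) * unitBallVolume (d - 1) *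
          ENNReal.ofReal (5 * 2 ^ d * (2 / ‖v‖) ^ (d - 1))) := by
        gcongr; exact hint.trans (by gcongr)
    _ = _ := by
        rw [mul_comm (ENNReal.ofReal (a ^ (d - 1))), mul_assoc,
          ← mul_assoc (unitBallVolume (d - 1))⁻¹,
          ENNReal.inv_mul_cancel (unitBallVolume_ne_zero _) (unitBallVolume_ne_top _), one_mul]

theorem lineMeasure_hitting_closedBall_ne_top (hd : 2 ≤ d) (x : Space d) {a : ℝ} (ha : 0 ≤ a) :
    lineMeasure d (hitting (closedBall x a)) ≠ ∞ := by
  rw [lineMeasure_hitting_closedBall hd x ha]; exact ENNReal.ofReal_ne_top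

theorem lineMeasure_real_hitting_closedBall (hd : 2 ≤ d) (x : Space d) {a : ℝ} (ha : 0 ≤ a) :
    (lineMeasure d).real (hitting (closedBall x a)) = a ^ (d - 1) := by
  rw [measureReal_def, lineMeasure_hitting_closedBall hd x ha,
    ENNReal.toReal_ofReal (by positivity)]

theorem lineMeasure_real_hitting_inter_le (hd : 2 ≤ d) {x y : Space d} (hxy : 2 ≤ dist x y)
    {a : ℝ} (ha0 : 0 ≤ a) (ha1 : a ≤ 1) :
    (lineMeasure d).real (hitting (closedBall x a) ∩ hitting (closedBall y a)) ≤
      a ^ (d - 1) * (5 * 2 ^ d * (2 / dist x y) ^ (d - 1)) := by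
  have h := lineMeasure_hitting_inter_le hd x (v := y - x)
    (by rwa [← dist_eq_norm, dist_comm]) ha0 ha1
  rw [add_sub_cancel, ← dist_eq_norm, dist_comm y x, ← ENNReal.ofReal_mul (by positivity)] at h
  rw [measureReal_def]
  exact ENNReal.toReal_le_of_le_ofReal (by positivity) h

theorem le_lineMeasure_real_hitting_diff_of_far (hd : 2 ≤ d) {x y : Space d} (hxy : 3 ≤ dist x y)
    {a : ℝ} (ha0 : 0 ≤ a) (ha1 : a ≤ 1) :
    a ^ (d - 1) / 2 ≤
      (lineMeasure d).real (hitting (closedBall x a) \ hitting (closedBall y a)) := by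
  have h := le_lineMeasure_hitting_diff hd x (v := y - x)
    (by rwa [← dist_eq_norm, dist_comm]) ha0 ha1
  rw [add_sub_cancel] at h
  have h2 := ENNReal.toReal_mono (measure_ne_top_of_subset Set.sdiff_subset
    (lineMeasure_hitting_closedBall_ne_top hd x ha0)) h
  rw [ENNReal.toReal_mul, ENNReal.toReal_ofReal (by positivity), ENNReal.toReal_inv] at h2
  simpa [measureReal_def, div_eq_mul_inv] using h2

/-- Repeating the displacement n = ⌈3/|x-y|⌉ times reaches distance at least 3, where at least half
of the lines are lost. Each step loses at least a fraction 1/(2n), and n|x-y| ≤ 6 gives the constant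
12. -/
theorem le_lineMeasure_real_hitting_diff_of_near (hd : 2 ≤ d) {x y : Space d} (hne : x ≠ y)
    (hxy : dist x y ≤ 3) {a : ℝ} (ha0 : 0 ≤ a) (ha1 : a ≤ 1) :
    a ^ (d - 1) * dist x y / 12 ≤
      (lineMeasure d).real (hitting (closedBall x a) \ hitting (closedBall y a)) := by
  have hpos : 0 < dist x y := dist_pos.2 hne
  set n : ℕ := ⌈3 / dist x y⌉₊ with hn
  have hn1 : 3 / dist x y ≤ n := Nat.le_ceil _
  have hn2 : (n : ℝ) < 3 / dist x y + 1 := Nat.ceil_lt_add_one (by positivity)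
  have hfar : 3 ≤ dist x (x + n • (y - x)) := by
    rw [dist_self_add_right, ← Nat.cast_smul_eq_nsmul ℝ, norm_smul, ← dist_eq_norm, dist_comm y x]
    simp only [Real.norm_natCast]
    exact (div_le_iff₀ hpos).1 hn1
  have h1 := le_lineMeasure_real_hitting_diff_of_far hd hfar ha0 ha1
  have h2 := lineMeasure_hitting_diff_nsmul_le x (y - x) a n
  rw [add_sub_cancel] at h2
  have htop : lineMeasure d (hitting (closedBall x a) \ hitting (closedBall y a)) ≠ ∞ :=
    measure_ne_top_of_subset Set.sdiff_subset (lineMeasure_hitting_closedBall_ne_top hd x ha0)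
  have h3 := ENNReal.toReal_mono (ENNReal.mul_ne_top (ENNReal.natCast_ne_top n) htop) h2
  rw [ENNReal.toReal_mul, ENNReal.toReal_natCast] at h3
  rw [measureReal_def] at h1 ⊢
  set h := (lineMeasure d (hitting (closedBall x a) \ hitting (closedBall y a))).toReal
  have hh : 0 ≤ h := ENNReal.toReal_nonneg
  have h4 : (n : ℝ) * dist x y ≤ 6 := by
    have : 3 / dist x y * dist x y = 3 := by field_simp
    nlinarith
  have h5 : a ^ (d - 1) / 2 ≤ n * h := h1.trans h3
  nlinarith

/-! ### Packing and the correlation sum -/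

/-- A packing bound. -/
theorem card_filter_dist_le {ρ : ℝ} (hρ : 0 < ρ) {S : Finset (Space d)}
    (hS : IsRhoSeparated ρ S) (x : Space d) {R : ℝ} (hR : 0 ≤ R) :
    ((S.filter fun y => dist x y ≤ R).card : ℝ) ≤ (1 + 2 * R / ρ) ^ d := by
  set T := S.filter fun y => dist x y ≤ R with hT
  have hdisj : (T : Set (Space d)).PairwiseDisjoint fun y => ball y (ρ / 2) := by
    intro y hy z hz hyz
    refine ball_disjoint_ball ?_
    have := hS y (Finset.mem_filter.1 hy).1 z (Finset.mem_filter.1 hz).1 hyz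
    linarith
  have hsub : (⋃ y ∈ T, ball y (ρ / 2)) ⊆ ball x (R + ρ / 2) := by
    refine Set.iUnion₂_subset fun y hy => ball_subset_ball' ?_
    have := (Finset.mem_filter.1 hy).2
    rw [dist_comm y x]; linarith
  have h := measure_mono (μ := volume) hsub
  rw [measure_biUnion_finset hdisj fun _ _ => measurableSet_ball] at h
  have hb : ∀ z : Space d, ∀ r : ℝ, 0 < r → volume (ball z r) =
      ENNReal.ofReal (r ^ d) * volume (ball (0 : Space d) 1) := fun z r hr => by
    rw [Measure.addHaar_ball_of_pos _ _ hr, finrank_euclideanSpace_fin]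
  rw [Finset.sum_congr rfl fun z _ => hb z _ (half_pos hρ), hb x _ (by positivity),
    Finset.sum_const, nsmul_eq_mul, ← mul_assoc] at h
  have h2 := (ENNReal.mul_le_mul_iff_left (measure_ball_pos _ _ one_pos).ne'
    measure_ball_lt_top.ne).1 h
  rw [← ENNReal.ofReal_natCast, ← ENNReal.ofReal_mul (by positivity),
    ENNReal.ofReal_le_ofReal_iff (by positivity)] at h2
  have e : (R + ρ / 2) ^ d = (1 + 2 * R / ρ) ^ d * (ρ / 2) ^ d := by
    rw [← mul_pow]; congr 1; field_simp; ring
  rw [e] at h2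
  exact le_of_mul_le_mul_right h2 (by positivity)

theorem summable_two_mul_add_three_pow (d : ℕ) :
    Summable fun k : ℕ => (2 * (k : ℝ) + 3) ^ d * (1 / 2 : ℝ) ^ k := by
  have h := summable_pow_mul_geometric_of_norm_lt_one d (r := (1 / 2 : ℝ)) (by norm_num)
  have h2 := ((summable_nat_add_iff 2).2 h).mul_left (2 ^ d * 4)
  refine Summable.of_nonneg_of_le (fun k => by positivity) (fun k => ?_) h2
  have e : 2 ^ d * 4 * (((k + 2 : ℕ) : ℝ) ^ d * (1 / 2 : ℝ) ^ (k + 2)) =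
      (2 * (k : ℝ) + 4) ^ d * (1 / 2 : ℝ) ^ k := by
    rw [show (2 * (k : ℝ) + 4) = 2 * ((k + 2 : ℕ) : ℝ) by push_cast; ring, mul_pow]
    ring
  rw [e]
  gcongr
  norm_num

/-- Summation over the points of a separated set, grouped by their distance from a point. -/
theorem sum_floor_dist_div_le {ρ : ℝ} (hρ : 0 < ρ) {S : Finset (Space d)}
    (hS : IsRhoSeparated ρ S) (x : Space d) :
    ∑ y ∈ S, (1 / 2 : ℝ) ^ ⌊dist x y / ρ⌋₊ ≤
      ∑' k : ℕ, (2 * (k : ℝ) + 3) ^ d * (1 / 2 : ℝ) ^ k := by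
  classical
  set f : Space d → ℕ := fun y => ⌊dist x y / ρ⌋₊ with hf
  rw [← Finset.sum_fiberwise_of_maps_to (s := S) (t := S.image f) (g := f)
    (fun y hy => Finset.mem_image_of_mem f hy)]
  refine le_trans (Finset.sum_le_sum fun k _ => ?_)
    ((summable_two_mul_add_three_pow d).sum_le_tsum _ fun k _ => by positivity)
  rw [Finset.sum_congr rfl (g := fun _ => (1 / 2 : ℝ) ^ k)
    (fun y hy => by rw [← (Finset.mem_filter.1 hy).2]), Finset.sum_const, nsmul_eq_mul]
  gcongr
  -- The k-th shell lies within distance (k + 1)ρ, so its packing bound (2k + 3)^d is free of ρ;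
  -- this lets the final constant depend on d alone.
  have h := card_filter_dist_le hρ hS x (R := (k + 1) * ρ) (by positivity)
  have e : 1 + 2 * ((k + 1) * ρ) / ρ = 2 * (k : ℝ) + 3 := by field_simp; ring
  rw [e] at h
  refine le_trans ?_ h
  norm_cast
  refine Finset.card_le_card fun y hy => ?_
  obtain ⟨hy1, hy2⟩ := Finset.mem_filter.1 hy
  refine Finset.mem_filter.2 ⟨hy1, ?_⟩
  have h3 := Nat.lt_floor_add_one (dist x y / ρ)
  rw [div_lt_iff₀ hρ] at h3
  have h4 : ⌊dist x y / ρ⌋₊ = k := hy2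
  rw [h4] at h3
  push_cast
  exact h3.le

theorem log_le_mul_rpow {N : ℝ} (hN : 1 < N) : Real.log N ≤ 96 * N ^ (1 / 96 : ℝ) := by
  have := Real.log_le_rpow_div (x := N) (by linarith) (ε := 1 / 96) (by norm_num)
  linarith

/-- Keeps the rescaled time log N + z at least (log N)/2 down to z = -log log N. -/
theorem log_log_le_half_log {N : ℝ} (hN : 1 < N) :
    Real.log (Real.log N) ≤ Real.log N / 2 := by
  have h0 := Real.log_pos hN
  have h1 := Real.log_le_sub_one_of_pos (half_pos h0)
  rw [Real.log_div h0.ne' (by norm_num)] at h1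
  have := Real.log_two_lt_d9
  linarith

/-- The total from far points: with e = e^{-τ} there are at most N terms e^{-τ}(e^δ - 1), and
Ne^{-τ} is at most logarithmic. The factor e^δ - 1 ≤ δe^{192K} supplies the decay, since 1/96 - 1/32
= -1/48. -/
theorem card_mul_exp_sub_one_le {N l m e δ K : ℝ} (hN : 0 < N) (hm : m ≤ N)
    (he0 : 0 ≤ e) (he : e ≤ l / N) (hl : l ≤ 96 * N ^ (1 / 96 : ℝ)) (hδ0 : 0 ≤ δ)
    (hδ1 : δ ≤ 192 * K * N ^ (-(1 / 32) : ℝ)) (hδ2 : δ ≤ 192 * K) :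
    m * (e * (Real.exp δ - 1)) ≤
      96 * (192 * K * Real.exp (192 * K)) * N ^ (-(1 / 48) : ℝ) := by
  have h3 : Real.exp δ - 1 ≤ δ * Real.exp (192 * K) := by
    have h4 := Real.one_sub_le_exp_neg δ
    have h5 : Real.exp (-δ) * Real.exp δ = 1 := by rw [← Real.exp_add]; simp
    have h6 : Real.exp δ ≤ Real.exp (192 * K) := Real.exp_le_exp.2 hδ2
    nlinarith [Real.exp_pos δ]
  have h0 : 0 ≤ Real.exp δ - 1 := by linarith [Real.one_le_exp hδ0]
  have hme : m * e ≤ l := by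
    calc m * e ≤ N * (l / N) := mul_le_mul hm he he0 hN.le
      _ = l := by field_simp
  have hE := Real.exp_pos (192 * K)
  calc m * (e * (Real.exp δ - 1)) = (m * e) * (Real.exp δ - 1) := by ring
    _ ≤ (96 * N ^ (1 / 96 : ℝ)) * (δ * Real.exp (192 * K)) :=
        mul_le_mul (hme.trans hl) h3 h0 (by positivity)
    _ ≤ (96 * N ^ (1 / 96 : ℝ)) *
        (192 * K * N ^ (-(1 / 32) : ℝ) * Real.exp (192 * K)) :=
        mul_le_mul_of_nonneg_left (mul_le_mul_of_nonneg_right hδ1 hE.le) (by positivity)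
    _ = 96 * (192 * K * Real.exp (192 * K)) * N ^ (1 / 96 + -(1 / 32) : ℝ) := by
        rw [Real.rpow_add hN]; ring
    _ = _ := by norm_num

/-- The correlation sum of the Stein–Chen bound, for an arbitrary separation function `g`. -/
theorem exists_sum_exp_sub_exp_le (hd : 2 ≤ d) (K : ℝ) (hK : 0 ≤ K) : ∃ C : ℝ, 0 < C ∧
    ∀ (ρ : ℝ) (S : Finset (Space d)) (x : Space d) (τ : ℝ) (g : Space d → ℝ),
      IsRhoSeparated ρ S → x ∈ S → 0 < ρ → ρ < 1 / 6 →
      1 ≤ Real.log S.card → 2 ≤ (S.card : ℝ) ^ (ρ / 200) →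
      ρ ^ (-(d : ℝ)) ≤ (S.card : ℝ) ^ (1 / 48 : ℝ) →
      Real.log S.card - Real.log (Real.log S.card) ≤ τ → τ ≤ 2 * Real.log S.card →
      (∀ y ∈ S, dist x y ≤ 3 → dist x y / 12 ≤ g y) →
      (∀ y ∈ S, 3 ≤ dist x y → 1 / 2 ≤ g y) →
      (∀ y ∈ S, 3 ≤ dist x y → 1 - K * (1 / dist x y) ^ (d - 1) ≤ g y) →
      ∑ y ∈ S.erase x, (Real.exp (-(τ * g y)) - Real.exp (-τ)) + Real.exp (-τ) ≤
        C * (S.card : ℝ) ^ (-ρ / 600) := by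
  classical
  set A : ℝ := ∑' k : ℕ, (2 * (k : ℝ) + 3) ^ d * (1 / 2 : ℝ) ^ k with hA
  have hA0 : 0 ≤ A := tsum_nonneg fun k => by positivity
  refine ⟨2 * A + 3 ^ d + 96 * (192 * K * Real.exp (192 * K)) + 96, by positivity, ?_⟩
  intro ρ S x τ g hS hx hρ0 hρ1 hlog h2 hρd hτ1 hτ2 hnear hmid hfar
  have hN1 : 1 < (S.card : ℝ) := by
    by_contra hcon
    have := Real.log_nonpos (Nat.cast_nonneg S.card) (not_lt.1 hcon)
    linarith
  obtain ⟨N, hNdef⟩ : ∃ N : ℝ, (S.card : ℝ) = N := ⟨_, rfl⟩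
  rw [hNdef] at hlog h2 hρd hτ1 hτ2 hN1 ⊢
  have hN0 : 0 < N := by linarith
  obtain ⟨l, hl⟩ : ∃ l, l = Real.log N := ⟨_, rfl⟩
  rw [← hl] at hlog hτ1 hτ2
  have hrpow : ∀ s : ℝ, Real.exp (l * s) = N ^ s := fun s => by
    rw [hl, Real.rpow_def_of_pos hN0 s]
  have hτhalf : l / 2 ≤ τ := by
    have := log_log_le_half_log hN1
    rw [← hl] at this
    linarith
  have hτ0 : 0 ≤ τ := by linarith
  have hmono : ∀ s : ℝ, s ≤ -ρ / 600 → N ^ s ≤ N ^ (-ρ / 600) := fun s hs =>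
    Real.rpow_le_rpow_of_exponent_le hN1.le hs
  -- the distance scale
  set D : ℝ := N ^ (1 / (12 * (d : ℝ))) with hD
  have hd0 : (0 : ℝ) < d := by exact_mod_cast (by omega : 0 < d)
  have hd2 : (2 : ℝ) ≤ d := by exact_mod_cast hd
  have hD1 : 1 ≤ D := Real.one_le_rpow hN1.le (by positivity)
  -- The scale balances two demands: the at most (3D/ρ)^d ≤ 3^d N^{1/12+1/48} points within D must
  -- be beaten by N^{-1/4}, while D^{-(d-1)} ≤ N^{-1/24}, by d ≥ 2, must beat the logarithm in τ.
  have hDd : D ^ d = N ^ (1 / 12 : ℝ) := by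
    rw [hD, ← Real.rpow_natCast, ← Real.rpow_mul hN0.le]; congr 1; field_simp
  have hDd1 : (1 / D) ^ (d - 1) ≤ N ^ (-(1 / 24) : ℝ) := by
    rw [one_div, inv_pow, hD, ← Real.rpow_natCast, ← Real.rpow_mul hN0.le, ← Real.rpow_neg hN0.le]
    refine Real.rpow_le_rpow_of_exponent_le hN1.le ?_
    rw [Nat.cast_sub (by omega), Nat.cast_one, neg_le_neg_iff, div_mul_eq_mul_div,
      div_le_div_iff₀ (by norm_num) (by positivity)]
    linarith
  have hpexp : Real.exp (-τ) ≤ l / N := by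
    have h : Real.exp (-τ) ≤ Real.exp (Real.log l - l) := Real.exp_le_exp.2 (by linarith)
    rwa [Real.exp_sub, Real.exp_log (by linarith), hl, Real.exp_log hN0,
      ← hl] at h
  have hl96 : l ≤ 96 * N ^ (1 / 96 : ℝ) := hl ▸ log_le_mul_rpow hN1
  set δ : ℝ := τ * (K * (1 / D) ^ (d - 1)) with hδ
  have hδ0 : 0 ≤ δ := by positivity
  have hδ1 : δ ≤ 192 * K * N ^ (-(1 / 32) : ℝ) := by
    calc δ ≤ (2 * (96 * N ^ (1 / 96 : ℝ))) * (K * N ^ (-(1 / 24) : ℝ)) := by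
          rw [hδ]; gcongr; linarith
      _ = 192 * K * (N ^ (1 / 96 : ℝ) * N ^ (-(1 / 24) : ℝ)) := by ring
      _ = _ := by rw [← Real.rpow_add hN0]; norm_num
  have hδ2 : δ ≤ 192 * K := hδ1.trans (mul_le_of_le_one_right (by positivity)
    (Real.rpow_le_one_of_one_le_of_nonpos hN1.le (by norm_num)))
  -- For near points at distance at least kρ, τ ≥ (log N)/2 and g ≥ kρ/12 give e^{-τg} ≤ q^k.
  set q : ℝ := N ^ (-ρ / 24) with hq
  have hq0 : 0 ≤ q := by positivity
  have hqhalf : q ≤ 1 / 2 := by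
    have h3 : (2 : ℝ) ≤ N ^ (ρ / 24) :=
      h2.trans (Real.rpow_le_rpow_of_exponent_le hN1.le (by linarith))
    rw [hq, neg_div, Real.rpow_neg hN0.le, one_div]
    exact inv_anti₀ (by norm_num) h3
  -- bound of a single summand
  have hterm : ∀ y ∈ S.erase x, Real.exp (-(τ * g y)) - Real.exp (-τ) ≤
      2 * q * (1 / 2 : ℝ) ^ ⌊dist x y / ρ⌋₊ + (if dist x y ≤ D then N ^ (-(1 / 4) : ℝ) else 0) +
        Real.exp (-τ) * (Real.exp δ - 1) := by
    intro y hy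
    obtain ⟨hyx, hyS⟩ := Finset.mem_erase.1 hy
    have hexp0 := Real.exp_pos (-τ)
    have t1 : 0 ≤ 2 * q * (1 / 2 : ℝ) ^ ⌊dist x y / ρ⌋₊ := by positivity
    have t2 : 0 ≤ (if dist x y ≤ D then N ^ (-(1 / 4) : ℝ) else 0) := by
      split_ifs <;> positivity
    have t3 : 0 ≤ Real.exp (-τ) * (Real.exp δ - 1) :=
      mul_nonneg hexp0.le (by linarith [Real.one_le_exp hδ0])
    rcases le_or_gt (dist x y) 3 with h3 | h3
    · have hk : 1 ≤ ⌊dist x y / ρ⌋₊ := by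
        rw [Nat.one_le_floor_iff, le_div_iff₀ hρ0, one_mul]
        exact hS x hx y hyS (Ne.symm hyx)
      have hkr : (⌊dist x y / ρ⌋₊ : ℝ) * ρ ≤ dist x y := by
        rw [← le_div_iff₀ hρ0]; exact Nat.floor_le (by positivity)
      obtain ⟨k, hk'⟩ := Nat.exists_eq_add_of_le' hk
      rw [hk'] at hkr ⊢ t1
      have h5 : Real.exp (-(τ * g y)) ≤ q ^ (k + 1) := by
        have h6 : q ^ (k + 1) = Real.exp (l * (-ρ / 24 * (k + 1 : ℕ))) := by
          rw [hrpow, hq, ← Real.rpow_natCast, ← Real.rpow_mul hN0.le]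
        rw [h6]
        refine Real.exp_le_exp.2 ?_
        have h7 := hnear y hyS h3
        have h8 : l / 2 * (((k + 1 : ℕ) : ℝ) * ρ / 12) ≤ τ * g y :=
          mul_le_mul hτhalf (by linarith) (by positivity) hτ0
        linarith
      have h9 : q ^ (k + 1) ≤ 2 * q * (1 / 2 : ℝ) ^ (k + 1) := by
        rw [pow_succ', pow_succ']
        have : q ^ k ≤ (1 / 2 : ℝ) ^ k := pow_le_pow_left₀ hq0 hqhalf k
        nlinarith
      linarith
    · rcases le_or_gt (dist x y) D with hyD | hyD
      · rw [if_pos hyD]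
        have h7 := hmid y hyS h3.le
        have h8 : Real.exp (-(τ * g y)) ≤ N ^ (-(1 / 4) : ℝ) := by
          rw [← hrpow]
          refine Real.exp_le_exp.2 ?_
          have : l / 2 * (1 / 2) ≤ τ * g y := mul_le_mul hτhalf h7 (by positivity) hτ0
          linarith
        linarith
      -- Beyond D the exponent is within δ of τ, so only the excess e^{-τ}(e^δ - 1) over the
      -- independent case remains.
      · have h7 := hfar y hyS h3.le
        have h8 : (1 / dist x y) ^ (d - 1) ≤ (1 / D) ^ (d - 1) :=
          pow_le_pow_left₀ (by positivity) (one_div_le_one_div_of_le (by linarith) hyD.le) _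
        have h9 : Real.exp (-(τ * g y)) ≤ Real.exp (-τ) * Real.exp δ := by
          rw [← Real.exp_add]
          refine Real.exp_le_exp.2 ?_
          have h10 : τ * (1 - K * (1 / D) ^ (d - 1)) ≤ τ * g y := by
            gcongr
            refine le_trans ?_ h7
            gcongr
          rw [hδ]; linarith
        linarith
  have hsum := Finset.sum_le_sum hterm
  rw [Finset.sum_add_distrib, Finset.sum_add_distrib, ← Finset.mul_sum, Finset.sum_const,
    nsmul_eq_mul, ← Finset.sum_filter, Finset.sum_const, nsmul_eq_mul] at hsum
  have hb1 : 2 * q * ∑ y ∈ S.erase x, (1 / 2 : ℝ) ^ ⌊dist x y / ρ⌋₊ ≤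
      2 * A * N ^ (-ρ / 600) := by
    have h1 : ∑ y ∈ S.erase x, (1 / 2 : ℝ) ^ ⌊dist x y / ρ⌋₊ ≤ A :=
      (Finset.sum_le_sum_of_subset_of_nonneg (Finset.erase_subset x S)
        fun y _ _ => by positivity).trans (sum_floor_dist_div_le hρ0 hS x)
    calc _ ≤ 2 * N ^ (-ρ / 600) * A := by
          gcongr
          exact hmono _ (by linarith)
      _ = _ := by ring
  have hb2 : (((S.erase x).filter fun y => dist x y ≤ D).card : ℝ) * N ^ (-(1 / 4) : ℝ) ≤
      3 ^ d * N ^ (-ρ / 600) := by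
    have h1 : (((S.erase x).filter fun y => dist x y ≤ D).card : ℝ) ≤ (1 + 2 * D / ρ) ^ d := by
      refine le_trans ?_ (card_filter_dist_le hρ0 hS x (R := D) (by linarith))
      exact_mod_cast Finset.card_le_card (Finset.filter_subset_filter _ (Finset.erase_subset x S))
    have h3 : (1 + 2 * D / ρ) ^ d ≤ (3 * D / ρ) ^ d := by
      refine pow_le_pow_left₀ (by positivity) ?_ d
      have : 1 ≤ D / ρ := by rw [le_div_iff₀ hρ0]; linarith
      have e1 : 3 * D / ρ = D / ρ + 2 * D / ρ := by ring
      linarith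
    have h4 : (3 * D / ρ) ^ d = 3 ^ d * (N ^ (1 / 12 : ℝ) * ρ ^ (-(d : ℝ))) := by
      rw [div_pow, mul_pow, hDd, Real.rpow_neg hρ0.le, Real.rpow_natCast]
      ring
    calc _ ≤ 3 ^ d * (N ^ (1 / 12 : ℝ) * N ^ (1 / 48 : ℝ)) * N ^ (-(1 / 4) : ℝ) := by
          refine mul_le_mul_of_nonneg_right ((h1.trans h3).trans ?_) (by positivity)
          rw [h4]; gcongr
      _ = 3 ^ d * N ^ (1 / 12 + 1 / 48 + -(1 / 4) : ℝ) := by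
          rw [Real.rpow_add hN0, Real.rpow_add hN0]; ring
      _ ≤ _ := mul_le_mul_of_nonneg_left (hmono _ (by linarith)) (by positivity)
  have hb3 : ((S.erase x).card : ℝ) * (Real.exp (-τ) * (Real.exp δ - 1)) ≤
      96 * (192 * K * Real.exp (192 * K)) * N ^ (-ρ / 600) := by
    have h1 : ((S.erase x).card : ℝ) ≤ N := by
      rw [← hNdef]
      exact Nat.cast_le.2 (Finset.card_le_card (Finset.erase_subset x S))
    exact (card_mul_exp_sub_one_le hN0 h1 (Real.exp_pos _).le hpexp hl96 hδ0
      hδ1 hδ2).trans (mul_le_mul_of_nonneg_left (hmono _ (by linarith)) (by positivity))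
  have hb4 : Real.exp (-τ) ≤ 96 * N ^ (-ρ / 600) := by
    calc _ ≤ l / N := hpexp
      _ ≤ 96 * N ^ (1 / 96 : ℝ) / N := by gcongr
      _ = 96 * N ^ (1 / 96 - 1 : ℝ) := by rw [Real.rpow_sub_one hN0.ne']; ring
      _ ≤ _ := mul_le_mul_of_nonneg_left (hmono _ (by linarith)) (by positivity)
  calc _ ≤ _ := add_le_add hsum hb4
    _ ≤ 2 * A * N ^ (-ρ / 600) + 3 ^ d * N ^ (-ρ / 600) +
        96 * (192 * K * Real.exp (192 * K)) * N ^ (-ρ / 600) + 96 * N ^ (-ρ / 600) := by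
        linarith
    _ = _ := by ring

/-! ### Void events of a Poisson process -/

section Void

variable {Ω X : Type*}

/-- The event that the point process `Ψ` has no point in `B`. -/
def voidEvent (Ψ : Ω → Set X) (B : Set X) : Set Ω := {ω | Ψ ω ∩ B = ∅}

theorem voidEvent_union (Ψ : Ω → Set X) (A B : Set X) :
    voidEvent Ψ (A ∪ B) = voidEvent Ψ A ∩ voidEvent Ψ B := by
  ext ω
  simp [voidEvent, Set.inter_union_distrib_left, Set.union_empty_iff]

theorem voidEvent_biUnion {ι : Type*} (Ψ : Ω → Set X) (U : Finset ι) (B : ι → Set X) :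
    voidEvent Ψ (⋃ y ∈ U, B y) = ⋂ y ∈ U, voidEvent Ψ (B y) := by
  ext ω
  simp [voidEvent, Set.inter_iUnion, Set.iUnion_eq_empty]

theorem voidEvent_anti (Ψ : Ω → Set X) {A B : Set X} (h : A ⊆ B) :
    voidEvent Ψ B ⊆ voidEvent Ψ A := fun _ hω =>
  Set.subset_eq_empty (Set.inter_subset_inter_right _ h) hω

theorem voidEvent_eq_preimage (Ψ : Ω → Set X) (B : Set X) :
    voidEvent Ψ B = (fun ω => (Ψ ω ∩ B).encard) ⁻¹' {0} := by
  ext ω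
  simp [voidEvent]

variable [MeasurableSpace Ω] [MeasurableSpace X] {Ψ : Ω → Set X} {μ : Measure X} {P : Measure Ω}

theorem IsPoissonProcess.measurableSet_voidEvent (h : IsPoissonProcess Ψ μ P) {B : Set X}
    (hB : MeasurableSet B) : MeasurableSet (voidEvent Ψ B) := by
  rw [voidEvent_eq_preimage]
  exact h.measurable_count B hB (measurableSet_singleton 0)

theorem IsPoissonProcess.measureReal_voidEvent (h : IsPoissonProcess Ψ μ P) {B : Set X}
    (hB : MeasurableSet B) (hfin : μ B ≠ ∞) : P.real (voidEvent Ψ B) = Real.exp (-μ.real B) := by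
  have h1 := congrArg (fun ν : Measure ℕ∞ => ν {0}) (h.law_count B hB hfin)
  rw [Measure.map_apply (h.measurable_count B hB) (measurableSet_singleton 0),
    Measure.map_apply Measurable.of_discrete (measurableSet_singleton 0)] at h1
  have h2 : ((↑) : ℕ → ℕ∞) ⁻¹' {0} = {0} := by ext n; simp
  rw [h2] at h1
  rw [voidEvent_eq_preimage, measureReal_def, h1, ← measureReal_def, poissonMeasure_real_singleton]
  simp [measureReal_def, ENNReal.toReal]

/-- Void probabilities are exponentials of minus the measure, and the measure is additive on
disjoint sets. -/
theorem IsPoissonProcess.measureReal_voidEvent_inter (h : IsPoissonProcess Ψ μ P) {A B : Set X}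
    (hA : MeasurableSet A) (hB : MeasurableSet B) (hAfin : μ A ≠ ∞) (hBfin : μ B ≠ ∞)
    (hdisj : Disjoint A B) :
    P.real (voidEvent Ψ A ∩ voidEvent Ψ B) = P.real (voidEvent Ψ A) * P.real (voidEvent Ψ B) := by
  rw [← voidEvent_union, h.measureReal_voidEvent (hA.union hB) (measure_union_ne_top hAfin hBfin),
    h.measureReal_voidEvent hA hAfin, h.measureReal_voidEvent hB hBfin,
    measureReal_union hdisj hB hAfin hBfin, neg_add, Real.exp_add]

end Void

/-! ### Coverage at a fixed time -/

theorem timeMeasure_setOf_le (t : ℝ) :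
    timeMeasure {s : ℝ≥0 | (s : ℝ) ≤ t} = ENNReal.ofReal t := by
  have he : MeasurableEmbedding ((↑) : ℝ≥0 → ℝ) := MeasurableEmbedding.subtype_coe measurableSet_Ici
  rw [timeMeasure, he.comap_apply]
  have : ((↑) : ℝ≥0 → ℝ) '' {s : ℝ≥0 | (s : ℝ) ≤ t} = Set.Icc 0 t := by
    ext r
    constructor
    · rintro ⟨s, hs, rfl⟩; exact ⟨s.2, hs⟩
    · rintro ⟨h0, h1⟩; exact ⟨⟨r, h0⟩, h1, rfl⟩
  rw [this, Real.volume_Icc, sub_zero]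

instance : SigmaFinite timeMeasure := by
  have he : MeasurableEmbedding ((↑) : ℝ≥0 → ℝ) := MeasurableEmbedding.subtype_coe measurableSet_Ici
  refine SigmaFinite.of_map _ he.measurable.aemeasurable ?_
  rw [timeMeasure, he.map_comap]
  infer_instance

/-- The lines from `H` with a time-stamp at most `t`. -/
def upToTime (H : Set (Line d)) (t : ℝ) : Set (Line d × ℝ≥0) := H ×ˢ {s : ℝ≥0 | (s : ℝ) ≤ t}

theorem measurableSet_upToTime {H : Set (Line d)} (hH : MeasurableSet H) (t : ℝ) :
    MeasurableSet (upToTime H t) :=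
  hH.prod (isClosed_le (by fun_prop) continuous_const).measurableSet

theorem measureReal_upToTime (H : Set (Line d)) {t : ℝ} (ht : 0 ≤ t) :
    ((lineMeasure d).prod timeMeasure).real (upToTime H t) = (lineMeasure d).real H * t := by
  rw [measureReal_def, upToTime, Measure.prod_prod, timeMeasure_setOf_le, ENNReal.toReal_mul,
    ENNReal.toReal_ofReal ht, measureReal_def]

theorem measure_upToTime_ne_top {H : Set (Line d)} (hH : lineMeasure d H ≠ ∞) (t : ℝ) : (lineMeasure d).prod timeMeasure (upToTime H t) ≠ ∞ := by
  rw [upToTime, Measure.prod_prod, timeMeasure_setOf_le]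
  exact ENNReal.mul_ne_top hH ENNReal.ofReal_ne_top

/-- The configurations for which all the balls `B(x, ρ)`, `x ∈ S`, are covered at time `t`. -/
def coverEvent {Ω : Type*} (Ψ : Ω → Set (Line d × ℝ≥0)) (ρ : ℝ) (S : Finset (Space d)) (t : ℝ) :
    Set Ω :=
  {ω | ∀ x ∈ S, ∃ p ∈ Ψ ω, closedBall x ρ ⊆ cylinder p.1 ∧ (p.2 : ℝ) ≤ t}

theorem coverEvent_mono {Ω : Type*} (Ψ : Ω → Set (Line d × ℝ≥0)) (ρ : ℝ) (S : Finset (Space d))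
    {s t : ℝ} (h : s ≤ t) : coverEvent Ψ ρ S s ⊆ coverEvent Ψ ρ S t := by
  intro ω hω x hx
  obtain ⟨p, h1, h2, h3⟩ := hω x hx
  exact ⟨p, h1, h2, h3.trans h⟩

theorem coverEvent_eq_biInter {Ω : Type*} (Ψ : Ω → Set (Line d × ℝ≥0)) {ρ : ℝ} (h0 : 0 ≤ ρ)
    (h1 : ρ ≤ 1) (S : Finset (Space d)) (t : ℝ) :
    coverEvent Ψ ρ S t =
      ⋂ x ∈ S, (voidEvent Ψ (upToTime (hitting (closedBall x (1 - ρ))) t))ᶜ := by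
  ext ω
  simp only [coverEvent, voidEvent, Set.mem_iInter, Set.mem_compl_iff, Set.mem_ofPred_eq]
  refine forall₂_congr fun x _ => ?_
  rw [← ne_eq, ← Set.nonempty_iff_ne_empty]
  refine exists_congr fun p => and_congr_right fun _ => ?_
  rw [closedBall_subset_cylinder_iff p.1 x h0 h1]
  rfl

theorem measureReal_voidEvent_ball {Ω : Type*} [MeasurableSpace Ω] {P : Measure Ω}
    {Ψ : Ω → Set (Line d × ℝ≥0)}
    (hΨ : IsPoissonProcess Ψ ((lineMeasure d).prod timeMeasure) P) (hd : 2 ≤ d) {ρ : ℝ}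
    (h1 : ρ ≤ 1) (x : Space d) {t : ℝ} (ht : 0 ≤ t) :
    P.real (voidEvent Ψ (upToTime (hitting (closedBall x (1 - ρ))) t)) =
      Real.exp (-(gam d ρ * t)) := by
  rw [hΨ.measureReal_voidEvent (measurableSet_upToTime (measurableSet_hitting_closedBall x _) t)
    (measure_upToTime_ne_top (lineMeasure_hitting_closedBall_ne_top hd x (by linarith)) t),
    measureReal_upToTime _ ht, lineMeasure_real_hitting_closedBall hd x (by linarith), gam]

/-- The Poisson approximation at a fixed time, in terms of the measures of the sets of lines that
cover one ball but not another one. -/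
theorem abs_measureReal_coverEvent_sub_le {Ω : Type*} [MeasurableSpace Ω] {P : Measure Ω}
    [IsProbabilityMeasure P] {Ψ : Ω → Set (Line d × ℝ≥0)}
    (hΨ : IsPoissonProcess Ψ ((lineMeasure d).prod timeMeasure) P) (hd : 2 ≤ d) {ρ : ℝ}
    (h0 : 0 ≤ ρ) (h1 : ρ ≤ 1) {S : Finset (Space d)} (hS : S.Nonempty) {t : ℝ} (ht : 0 ≤ t) {ε : ℝ}
    (hε : ∀ x ∈ S, ∑ y ∈ S.erase x,
      (Real.exp (-((lineMeasure d).real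
        (hitting (closedBall y (1 - ρ)) \ hitting (closedBall x (1 - ρ))) * t)) -
        Real.exp (-(gam d ρ * t))) + Real.exp (-(gam d ρ * t)) ≤ ε) :
    |P.real (coverEvent Ψ ρ S t) - Real.exp (-(S.card * Real.exp (-(gam d ρ * t))))| ≤ ε := by
  have ha : 0 ≤ 1 - ρ := by linarith
  set H : Space d → Set (Line d) := fun x => hitting (closedBall x (1 - ρ)) with hH
  have hHm : ∀ x, MeasurableSet (H x) := fun x => measurableSet_hitting_closedBall x _
  have hHf : ∀ x, lineMeasure d (H x) ≠ ∞ := fun x =>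
    lineMeasure_hitting_closedBall_ne_top hd x ha
  have hDm : ∀ x y, MeasurableSet (H y \ H x) := fun x y => (hHm y).diff (hHm x)
  have hDf : ∀ x y, lineMeasure d (H y \ H x) ≠ ∞ := fun x y =>
    measure_ne_top_of_subset Set.sdiff_subset (hHf y)
  rw [coverEvent_eq_biInter Ψ h0 h1]
  refine abs_measureReal_biInter_compl_sub_exp_le P hS
    (I := fun x => voidEvent Ψ (upToTime (H x) t))
    (J := fun x y => voidEvent Ψ (upToTime (H y \ H x) t))
    (fun x _ => hΨ.measurableSet_voidEvent (measurableSet_upToTime (hHm x) t))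
    (fun x _ y _ => hΨ.measurableSet_voidEvent (measurableSet_upToTime (hDm x y) t))
    (fun x _ y _ => voidEvent_anti Ψ (Set.prod_mono Set.sdiff_subset subset_rfl))
    (fun x _ y _ => ?_) (Real.exp_pos _) (fun x _ => measureReal_voidEvent_ball hΨ hd h1 x ht)
    (fun x _ U _ => ?_) (fun x hx => ?_)
  -- If both H_x and H_y \ H_x are empty of points up to time t, then so is H_y.
  · rw [← voidEvent_union]
    refine voidEvent_anti Ψ ?_
    rintro ⟨L, s⟩ ⟨hL, hs⟩
    by_cases hx : L ∈ H x
    · exact Or.inl ⟨hx, hs⟩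
    · exact Or.inr ⟨⟨hL, hx⟩, hs⟩
  -- A joint occurrence of the `J x y` is one void event, for a union of sets disjoint from H_x.
  · rw [← voidEvent_biUnion]
    refine hΨ.measureReal_voidEvent_inter (measurableSet_upToTime (hHm x) t)
      (Finset.measurableSet_biUnion U fun y _ => measurableSet_upToTime (hDm x y) t)
      (measure_upToTime_ne_top (hHf x) t) ?_ ?_
    · exact (measure_biUnion_lt_top U.finite_toSet fun y _ =>
        (measure_upToTime_ne_top (hDf x y) t).lt_top).ne
    · rw [Set.disjoint_iUnion₂_right]
      exact fun y _ => Set.disjoint_prod.2 (Or.inl Set.disjoint_sdiff_right)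
  · refine le_trans (le_of_eq ?_) (hε x hx)
    congr 1
    refine Finset.sum_congr rfl fun y _ => ?_
    rw [hΨ.measureReal_voidEvent (measurableSet_upToTime (hDm x y) t)
      (measure_upToTime_ne_top (hDf x y) t), measureReal_upToTime _ ht]

/-- A union bound over the points; it serves for large z, where coverage is almost certain. -/
theorem one_sub_measureReal_coverEvent_le {Ω : Type*} [MeasurableSpace Ω] {P : Measure Ω}
    [IsProbabilityMeasure P] {Ψ : Ω → Set (Line d × ℝ≥0)}
    (hΨ : IsPoissonProcess Ψ ((lineMeasure d).prod timeMeasure) P) (hd : 2 ≤ d) {ρ : ℝ}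
    (h0 : 0 ≤ ρ) (h1 : ρ ≤ 1) (S : Finset (Space d)) {t : ℝ} (ht : 0 ≤ t) :
    1 - P.real (coverEvent Ψ ρ S t) ≤ S.card * Real.exp (-(gam d ρ * t)) := by
  have hm : MeasurableSet (coverEvent Ψ ρ S t) := by
    rw [coverEvent_eq_biInter Ψ h0 h1]
    exact Finset.measurableSet_biInter S fun x _ => (hΨ.measurableSet_voidEvent
      (measurableSet_upToTime (measurableSet_hitting_closedBall x _) t)).compl
  rw [← probReal_compl_eq_one_sub hm, coverEvent_eq_biInter Ψ h0 h1]
  simp only [Set.compl_iInter, compl_compl]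
  refine (measureReal_biUnion_finset_le _ _).trans (le_of_eq ?_)
  rw [Finset.sum_congr rfl fun x _ => measureReal_voidEvent_ball hΨ hd h1 x ht, Finset.sum_const,
    nsmul_eq_mul]

/-! ### Comparing the cover time with coverage at fixed times -/

theorem rescaled_wellCoverTime_le_iff {g : ℝ} (hg : 0 < g) (c z : ℝ) (T : EReal) :
    (g : EReal) * T - (c : EReal) ≤ (z : EReal) ↔ T ≤ (((c + z) / g : ℝ) : EReal) := by
  induction T with
  | bot => simp [EReal.coe_mul_bot_of_pos hg]
  | top => simp [EReal.coe_mul_top_of_pos hg]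
  | coe r =>
    rw [← EReal.coe_mul, ← EReal.coe_sub, EReal.coe_le_coe_iff, EReal.coe_le_coe_iff,
      le_div_iff₀ hg]
    constructor <;> intro h <;> linarith

theorem coverEvent_subset_wellCoverTime_le {Ω : Type*} (Ψ : Ω → Set (Line d × ℝ≥0)) (ρ : ℝ)
    (S : Finset (Space d)) {t : ℝ} (ht : 0 < t) :
    coverEvent Ψ ρ S t ⊆ {ω | wellCoverTime (Ψ ω) ρ S ≤ (t : EReal)} := by
  intro ω hω
  have h : t ∈ {t : ℝ | 0 < t ∧ ∀ x ∈ S, ∃ p ∈ Ψ ω, closedBall x ρ ⊆ cylinder p.1 ∧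
      (p.2 : ℝ) ≤ t} := ⟨ht, hω⟩
  change wellCoverTime (Ψ ω) ρ S ≤ (t : EReal)
  unfold wellCoverTime
  exact sInf_le (Set.mem_image_of_mem _ h)

/-- The infimum need not be attained, so coverage is only asserted at strictly later times; the loss
is later removed by a limit. -/
theorem wellCoverTime_le_subset_coverEvent {Ω : Type*} (Ψ : Ω → Set (Line d × ℝ≥0)) (ρ : ℝ)
    (S : Finset (Space d)) {t t' : ℝ} (ht : t < t') :
    {ω | wellCoverTime (Ψ ω) ρ S ≤ (t : EReal)} ⊆ coverEvent Ψ ρ S t' := by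
  intro ω hω
  have h : wellCoverTime (Ψ ω) ρ S < (t' : EReal) :=
    lt_of_le_of_lt hω (EReal.coe_lt_coe_iff.2 ht)
  obtain ⟨_, ⟨s, ⟨_, hs⟩, rfl⟩, hst⟩ := sInf_lt_iff.1 h
  exact coverEvent_mono Ψ ρ S (EReal.coe_lt_coe_iff.1 hst).le hs

/-- C ≤ 1 gives C/(1 + C) ≤ 1/2. This turns the exponent in the last condition into the 1/48 of the
correlation estimate. -/
theorem constCtilde_half_le (d : ℕ) : constCtilde d / 2 ≤ 1 / 48 := by
  have h0 : 0 ≤ constC d := by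
    unfold constC
    split_ifs
    · exact zero_le_one
    · exact Real.sqrt_nonneg _
  have h1 : constC d ≤ 1 := by
    unfold constC
    split_ifs
    · exact le_rfl
    · rw [Real.sqrt_le_one]
      have : (0 : ℝ) < (4 : ℝ) ^ (-1 / ((d : ℝ) - 2)) := by positivity
      linarith
  have h2 : constCtilde d ≤ 1 / 24 := by
    rw [constCtilde, div_le_div_iff₀ (by positivity) (by norm_num)]
    linarith
  linarith

/-! ### Gumbel approximation -/

/-- Convergence to the Gumbel distribution at deterministic times. -/
theorem exists_abs_coverEvent_sub_gumbel_le (hd : 2 ≤ d) : ∃ C : ℝ, 1 ≤ C ∧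
    ∀ (Ω : Type*) [MeasurableSpace Ω] (P : Measure Ω) [IsProbabilityMeasure P]
      (Ψ : Ω → Set (Line d × ℝ≥0)),
      IsPoissonProcess Ψ ((lineMeasure d).prod timeMeasure) P →
    ∀ (ρ : ℝ) (S : Finset (Space d)), IsRhoSeparated ρ S → 0 < ρ → ρ < 1 / 6 →
      1 ≤ Real.log S.card → 2 ≤ (S.card : ℝ) ^ (ρ / 200) →
      ρ ^ (-(d : ℝ)) ≤ (S.card : ℝ) ^ (1 / 48 : ℝ) →
      ∀ z : ℝ, -Real.log (Real.log S.card) ≤ z →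
        |P.real (coverEvent Ψ ρ S ((Real.log S.card + z) / gam d ρ)) -
          Real.exp (-Real.exp (-z))| ≤ C * (S.card : ℝ) ^ (-ρ / 600) := by
  -- K collects the constant 5·2^d(2/r)^{d-1} in the bound for lines meeting two balls at distance
  -- r.
  obtain ⟨C, hC, hmain⟩ := exists_sum_exp_sub_exp_le hd (5 * 2 ^ d * 2 ^ (d - 1)) (by positivity)
  refine ⟨max C 1, le_max_right _ _, ?_⟩
  intro Ω _ P _ Ψ hΨ ρ S hS hρ0 hρ1 hlog h2 hρd z hz
  have hN1 : 1 < (S.card : ℝ) := by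
    by_contra hcon
    have := Real.log_nonpos (Nat.cast_nonneg S.card) (not_lt.1 hcon)
    linarith
  have hN0 : 0 < (S.card : ℝ) := by linarith
  have hne : S.Nonempty := Finset.card_pos.1 (by exact_mod_cast hN0)
  have ha0 : 0 ≤ 1 - ρ := by linarith
  have ha1 : 1 - ρ ≤ 1 := by linarith
  have hg : 0 < gam d ρ := pow_pos (by linarith) _
  have hll := log_log_le_half_log hN1
  set t := (Real.log S.card + z) / gam d ρ with ht
  have hgt : gam d ρ * t = Real.log S.card + z := by rw [ht]; field_simp
  have ht0 : 0 ≤ t := div_nonneg (by linarith) hg.le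
  have hexp : S.card * Real.exp (-(gam d ρ * t)) = Real.exp (-z) := by
    rw [hgt, neg_add, Real.exp_add, Real.exp_neg (Real.log _), Real.exp_log hN0]
    field_simp
  have hrp0 : 0 ≤ (S.card : ℝ) ^ (-ρ / 600) := by positivity
  -- For z ≤ log N the rescaled time is at most 2 log N, as the correlation estimate requires.
  -- Beyond that, both probabilities lie in [1 - e^{-z}, 1] and e^{-z} < 1/N.
  rcases le_or_gt z (Real.log S.card) with hzl | hzl
  · have hCmax : C * (S.card : ℝ) ^ (-ρ / 600) ≤ max C 1 * (S.card : ℝ) ^ (-ρ / 600) :=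
      mul_le_mul_of_nonneg_right (le_max_left _ _) hrp0
    refine le_trans ?_ hCmax
    rw [← hexp]
    refine abs_measureReal_coverEvent_sub_le hΨ hd hρ0.le (by linarith) hne ht0 fun x hx => ?_
    set D : Space d → ℝ := fun y => (lineMeasure d).real
      (hitting (closedBall y (1 - ρ)) \ hitting (closedBall x (1 - ρ))) with hD
    have hmx := hmain ρ S x (gam d ρ * t) (fun y => D y / gam d ρ) hS hx hρ0 hρ1 hlog h2 hρd
      (by linarith) (by linarith) ?_ ?_ ?_
    · refine le_trans (le_of_eq ?_) hmx
      congr 1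
      refine Finset.sum_congr rfl fun y _ => ?_
      congr 3
      change D y * t = _
      field_simp
    · intro y _ hxy
      rw [le_div_iff₀ hg]
      by_cases hyx : y = x
      · rw [hyx, dist_self]; simp only [zero_div, zero_mul]; exact measureReal_nonneg
      · have h := le_lineMeasure_real_hitting_diff_of_near hd hyx (by rwa [dist_comm]) ha0 ha1
        rw [dist_comm y x] at h
        refine le_trans (le_of_eq ?_) h
        rw [gam]; ring
    · intro y _ hxy
      rw [le_div_iff₀ hg]
      have h := le_lineMeasure_real_hitting_diff_of_far hd (x := y) (y := x)
        (by rwa [dist_comm]) ha0 ha1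
      refine le_trans (le_of_eq ?_) h
      rw [gam]; ring
    · intro y _ hxy
      rw [le_div_iff₀ hg]
      have h := lineMeasure_real_hitting_inter_le hd (x := y) (y := x)
        (by rw [dist_comm]; linarith) ha0 ha1
      have h3 := measureReal_inter_add_sdiff (μ := lineMeasure d)
        (s := hitting (closedBall y (1 - ρ))) (measurableSet_hitting_closedBall x (1 - ρ))
        (lineMeasure_hitting_closedBall_ne_top hd y ha0)
      rw [lineMeasure_real_hitting_closedBall hd y ha0] at h3
      have h4 : D y = (1 - ρ) ^ (d - 1) - (lineMeasure d).real
          (hitting (closedBall y (1 - ρ)) ∩ hitting (closedBall x (1 - ρ))) := by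
        rw [← h3]; simp [hD]
      rw [h4, gam]
      rw [dist_comm y x, div_pow] at h
      rw [one_div, inv_pow]
      have e : (1 - 5 * 2 ^ d * 2 ^ (d - 1) * (dist x y ^ (d - 1))⁻¹) * (1 - ρ) ^ (d - 1) =
          (1 - ρ) ^ (d - 1) -
            (1 - ρ) ^ (d - 1) * (5 * 2 ^ d * (2 ^ (d - 1) / dist x y ^ (d - 1))) := by ring
      rw [e]
      linarith
  · have h3 := one_sub_measureReal_coverEvent_le hΨ hd hρ0.le (by linarith) S ht0
    rw [hexp] at h3
    have h4 : P.real (coverEvent Ψ ρ S t) ≤ 1 := measureReal_le_one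
    have h5 := Real.one_sub_le_exp_neg (Real.exp (-z))
    have h6 : Real.exp (-Real.exp (-z)) ≤ 1 := Real.exp_le_one_iff.2 (by linarith [Real.exp_pos (-z)])
    have h7 : Real.exp (-z) ≤ (S.card : ℝ) ^ (-ρ / 600) := by
      rw [Real.rpow_def_of_pos hN0]
      refine Real.exp_le_exp.2 ?_
      nlinarith
    have h8 : (S.card : ℝ) ^ (-ρ / 600) ≤ max C 1 * (S.card : ℝ) ^ (-ρ / 600) :=
      le_mul_of_one_le_left hrp0 (le_max_right _ _)
    rw [abs_le]
    constructor <;> linarith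

theorem gumbel_mono {z w : ℝ} (h : z ≤ w) :
    Real.exp (-Real.exp (-z)) ≤ Real.exp (-Real.exp (-w)) :=
  Real.exp_le_exp.2 (neg_le_neg (Real.exp_le_exp.2 (neg_le_neg h)))

/-- Convergence to the Gumbel distribution for the rescaled cover time. -/
theorem exists_abs_wellCoverTime_sub_gumbel_le (hd : 2 ≤ d) : ∃ C : ℝ, 0 < C ∧
    ∀ (Ω : Type*) [MeasurableSpace Ω] (P : Measure Ω) [IsProbabilityMeasure P]
      (Ψ : Ω → Set (Line d × ℝ≥0)),
      IsPoissonProcess Ψ ((lineMeasure d).prod timeMeasure) P →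
    ∀ (ρ : ℝ) (S : Finset (Space d)), IsRhoSeparated ρ S → 0 < ρ → ρ < 1 / 6 →
      1 ≤ Real.log S.card → 2 ≤ (S.card : ℝ) ^ (ρ / 200) →
      ρ ^ (-(d : ℝ)) ≤ (S.card : ℝ) ^ (1 / 48 : ℝ) →
      ∀ z : ℝ, |P.real {ω | (gam d ρ : EReal) * wellCoverTime (Ψ ω) ρ S
              - (Real.log S.card : EReal) ≤ (z : EReal)} - Real.exp (-Real.exp (-z))| ≤
          C * (S.card : ℝ) ^ (-ρ / 600) := by
  obtain ⟨C, hC, hmain⟩ := exists_abs_coverEvent_sub_gumbel_le hd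
  refine ⟨C + 1, by linarith, ?_⟩
  intro Ω _ P _ Ψ hΨ ρ S hS hρ0 hρ1 hlog h2 hρd z
  have hN1 : 1 < (S.card : ℝ) := by
    by_contra hcon
    have := Real.log_nonpos (Nat.cast_nonneg S.card) (not_lt.1 hcon)
    linarith
  have hN0 : 0 < (S.card : ℝ) := by linarith
  have hg : 0 < gam d ρ := pow_pos (by linarith) _
  have hll := log_log_le_half_log hN1
  have hF := hmain Ω P Ψ hΨ ρ S hS hρ0 hρ1 hlog h2 hρd
  set ε := C * (S.card : ℝ) ^ (-ρ / 600) with hε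
  have hrp0 : 0 ≤ (S.card : ℝ) ^ (-ρ / 600) := by positivity
  set E : ℝ → Set Ω := fun w => {ω | (gam d ρ : EReal) * wellCoverTime (Ψ ω) ρ S
              - (Real.log S.card : EReal) ≤ (w : EReal)} with hE
  have hEeq : ∀ w, E w = {ω | wellCoverTime (Ψ ω) ρ S ≤
      (((Real.log S.card + w) / gam d ρ : ℝ) : EReal)} := fun w =>
    Set.ext fun ω => rescaled_wellCoverTime_le_iff hg _ _ _
  have hEmono : ∀ {v w : ℝ}, v ≤ w → E v ⊆ E w := fun h ω hω =>
    le_trans hω (EReal.coe_le_coe_iff.2 h)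
  have hupper : ∀ w : ℝ, -Real.log (Real.log S.card) ≤ w →
      P.real (E w) ≤ Real.exp (-Real.exp (-w)) + ε := by
    intro w hw
    -- The bound holds with w + δ for every δ > 0 and the same ε; letting δ → 0 removes the shift.
    have hcont : Continuous fun δ : ℝ => Real.exp (-Real.exp (-(w + δ))) + ε := by fun_prop
    have htend := (hcont.tendsto 0).mono_left (nhdsWithin_le_nhds (s := Set.Ioi (0 : ℝ)))
    rw [add_zero] at htend
    refine ge_of_tendsto htend (eventually_nhdsWithin_of_forall fun δ hδ => ?_)
    have hδ0 : 0 < δ := hδ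
    have hsub : E w ⊆ coverEvent Ψ ρ S ((Real.log S.card + (w + δ)) / gam d ρ) := by
      rw [hEeq]
      exact wellCoverTime_le_subset_coverEvent Ψ ρ S
        (div_lt_div_of_pos_right (by linarith) hg)
    have h3 := (abs_le.1 (hF (w + δ) (by linarith))).2
    have h4 : P.real (E w) ≤ _ := measureReal_mono hsub
    linarith
  have hεle : ε ≤ (C + 1) * (S.card : ℝ) ^ (-ρ / 600) := by
    rw [hε]; linarith
  rcases le_or_gt (-Real.log (Real.log S.card)) z with hz | hz
  · have hlower : coverEvent Ψ ρ S ((Real.log S.card + z) / gam d ρ) ⊆ E z := by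
      rw [hEeq]
      exact coverEvent_subset_wellCoverTime_le Ψ ρ S (div_pos (by linarith) hg)
    have h3 := (abs_le.1 (hF z hz)).1
    have h4 : _ ≤ P.real (E z) := measureReal_mono hlower
    have h5 := hupper z hz
    rw [abs_le]
    constructor <;> linarith
  -- At this cutoff the Gumbel distribution function equals 1/N. Below it both distribution
  -- functions are at most 1/N + ε, which accounts for the constant C + 1.
  · set w := -Real.log (Real.log S.card) with hw
    have h3 := hupper w le_rfl
    have h4 : P.real (E z) ≤ P.real (E w) := measureReal_mono (hEmono hz.le)
    have h5 := gumbel_mono hz.le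
    have h6 : Real.exp (-Real.exp (-w)) ≤ (S.card : ℝ) ^ (-ρ / 600) := by
      rw [hw, neg_neg, Real.exp_log (by linarith), Real.rpow_def_of_pos hN0]
      refine Real.exp_le_exp.2 ?_
      nlinarith
    have h7 : 0 ≤ P.real (E z) := measureReal_nonneg
    have h8 := Real.exp_pos (-Real.exp (-z))
    have hε0 : 0 ≤ ε := by positivity
    rw [abs_le]
    constructor <;> linarith

end PoissonCylinder

/-! ### Reduction of the stated conditions -/

open PoissonCylinder
theorem mainTheorem3 (d : ℕ) (hd : 2 ≤ d) :
    ∃ c₃ : ℝ, 0 < c₃ ∧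
      ∀ (Ω : Type*) [MeasurableSpace Ω] (P : Measure Ω) [IsProbabilityMeasure P]
        (Ψ : Ω → Set (Line d × ℝ≥0)),
        IsPoissonProcess Ψ ((lineMeasure d).prod timeMeasure) P →
      ∀ (A : Set (Space d)), Bornology.IsBounded A →
      ∀ (ρ : ℝ) (S : Finset (Space d)), IsMaximalSeparated ρ A S →
        0 < ρ → ρ < min (((d : ℝ) - 1) / (6 * d)) (constC d / 5) →
        4 < (S.card : ℝ) ^ (1 / (2 * (d : ℝ))) →
        ρ * Real.log S.card ≤ (S.card : ℝ) ^ (ρ / 200) →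
        2 ≤ (S.card : ℝ) ^ (ρ / 200) →
        ρ ^ (-(d : ℝ)) * Real.log S.card ^ d ≤ (S.card : ℝ) ^ (constCtilde d / 2) →
        ⨆ z : ℝ, |P.real {ω | (gam d ρ : EReal) * wellCoverTime (Ψ ω) ρ S
              - (Real.log S.card : EReal) ≤ (z : EReal)} - Real.exp (-Real.exp (-z))|
          ≤ c₃ * (S.card : ℝ) ^ (-ρ / 600) := by
  obtain ⟨C, hC, hmain⟩ := exists_abs_wellCoverTime_sub_gumbel_le hd
  refine ⟨C, hC, ?_⟩
  intro Ω _ P _ Ψ hΨ A _ ρ S hS hρ0 hρ1 h4 _ h2 h5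
  have hd2 : (2 : ℝ) ≤ d := by exact_mod_cast hd
  have hρ : ρ < 1 / 6 := by
    refine (lt_of_lt_of_le hρ1 (min_le_left _ _)).trans_le ?_
    rw [div_le_div_iff₀ (by positivity) (by norm_num)]
    linarith
  have hN1 : 1 ≤ (S.card : ℝ) := by
    rcases Nat.eq_zero_or_pos S.card with h | h
    · rw [h, Nat.cast_zero, Real.zero_rpow (by positivity)] at h4
      linarith
    · exact_mod_cast h
  -- N^{1/(2d)} ≤ N for N ≥ 1. Then N > 4 > e yields log N ≥ 1, which allows the factor (log N)^d to
  -- be dropped below.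
  have hN4 : 4 < (S.card : ℝ) := by
    refine h4.trans_le (Real.rpow_le_self_of_one_le hN1 ?_)
    rw [div_le_one (by positivity)]
    linarith
  have hlog : 1 ≤ Real.log S.card := by
    rw [Real.le_log_iff_exp_le (by linarith)]
    linarith [Real.exp_one_lt_d9]
  have hρd : ρ ^ (-(d : ℝ)) ≤ (S.card : ℝ) ^ (1 / 48 : ℝ) :=
    calc ρ ^ (-(d : ℝ)) ≤ ρ ^ (-(d : ℝ)) * Real.log S.card ^ d :=
          le_mul_of_one_le_right (by positivity) (one_le_pow₀ hlog)
      _ ≤ _ := h5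
      _ ≤ _ := Real.rpow_le_rpow_of_exponent_le hN1 (constCtilde_half_le d)
  exact Real.iSup_le (hmain Ω P Ψ hΨ ρ S hS.separated hρ0 hρ hlog h2 hρd) (by positivity)
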